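/- **Theorem (Concentration).** For integers $d\ge 1$, $N\ge 1$ let $\mathbb T^d_N=(\mathbb Z/N\mathbb Z)^d$ with its nearest-neighbor graph structure, let $|x-y|$ be the graph distance, and let $\pi\equiv N^{-d}$ be the uniform distribution. The *averaging process* is the Markov jump process on the probability mass functions $\mathcal P(\mathbb T^d_N)$ with generator $$\mathcal L f(\eta)=\frac12\sum_{x}\sum_{y:\,|x-y|=1}\big(f(\eta^{xy})-f(\eta)\big),\qquad f\in \mathcal C(\mathcal P(\mathbb T^d_N)),$$ where $\eta^{xy}(z)=\frac12(\eta(x)+\eta(y))$ if $z\in\{x,y\}$ and $\eta^{xy}(z)=\eta(z)$ otherwise; $\eta_t(0,\cdot)$ denotes this process at time $t$ when started from the unit mass at $0$. The random walk on $\mathbb T^d_N$ is the continuous-time Markov chain with generator $L\psi(x)=\frac12\sum_{y:\,|x-y|=1}(\psi(y)-\psi(x))$; $\pi_t(0,\cdot)$ denotes its distribution at time $t$ when started from $0$, and $t_{\rm rel}=1/\lambda$, where $\lambda$ is the smallest non-zero eigenvalue of $-L$. Write $\|\psi\|_2^2=\sum_x\pi(x)|\psi(x)|^2$ and $$\Xi(t)=\frac{N^d\,e^{-2t/t_{\rm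 rel}}}{(N^{d+2}\wedge t^{d/2+1})\vee 1}.$$ For every $d\ge1$ there are constants $B,C_1,C_2>0$, depending only on $d$, such that for all $N$ large enough and all $t\ge0$, $$C_1(1\wedge t)\,\Xi(t)\;\le\;\mathbb E\left[\left\|\frac{\eta_t(0,\cdot)}{\pi}-\frac{\pi_t(0,\cdot)}{\pi}\right\|_2^2\right]\;\le\; C_2(1\wedge t)\,\Xi(t)\,\exp\left(\frac{Bt}{N^{d+2}}\right).$$ In particular, for every sequence of times $t_N\ge 0$ with $t_N/N^{2d/(d+2)}\to\infty$ as $N\to\infty$, $$\lim_{N\to\infty}\mathbb E\left[\left\|\frac{\eta_{t_N}(0,\cdot)}{\pi}-\frac{\pi_{t_N}(0,\cdot)}{\pi}\right\|_2^2\right]=0 .$$ -/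

import Mathlib

open MeasureTheory Filter Topology
open scoped NNReal

noncomputable section

/-- The vertex set of the discrete `d`-dimensional torus of size `N`, that is `(ℤ/Nℤ)^d`. -/
abbrev Torus (d N : ℕ) : Type := Fin d → ZMod N

/-- The nearest-neighbour graph on the torus: `x` and `y` are adjacent (at graph distance one)
if they are distinct and differ by a unit step in exactly one coordinate direction. -/
def torusGraph (d N : ℕ) : SimpleGraph (Torus d N) where
  Adj x y := x ≠ y ∧ ∃ i : Fin d, y = x + Pi.single i 1 ∨ x = y + Pi.single i 1
  symm := ⟨fun _ _ h => ⟨h.1.symm, h.2.imp fun _ => Or.symm⟩⟩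
  loopless := ⟨fun _ h => h.1 rfl⟩

instance (d N : ℕ) : DecidableRel (torusGraph d N).Adj :=
  fun x y => inferInstanceAs
    (Decidable (x ≠ y ∧ ∃ i : Fin d, y = x + Pi.single i 1 ∨ x = y + Pi.single i 1))

/-- The semigroup `e^{tA}` generated by a bounded operator `A` on a normed space, with the
exponential of operators given by its power series. -/
def operatorSemigroup {E : Type*} [NormedAddCommGroup E] [NormedSpace ℝ E] (A : E →L[ℝ] E)
    (t : ℝ≥0) : E →L[ℝ] E :=
  NormedSpace.exp ((t : ℝ) • A)

variable (d N : ℕ) [NeZero N]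

/-- The compact space of probability mass functions on the torus. -/
abbrev MassSpace : Type := stdSimplex ℝ (Torus d N)

/-- The uniform distribution on the torus. -/
def uniformMass (_x : Torus d N) : ℝ := 1 / (N : ℝ) ^ d

/-- The square of the norm of `L²` of the torus with respect to the uniform distribution. -/
def l2NormSq (ψ : Torus d N → ℝ) : ℝ := ∑ x, uniformMass d N x * |ψ x| ^ 2

/-- The unit mass at a vertex, as an element of the space of probability mass functions. -/
def diracMass (x : Torus d N) : MassSpace d N := ⟨Pi.single x 1, single_mem_stdSimplex ℝ x⟩

/-! ### The random walk and its heat flow -/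

/-- The generator of the random walk:
`L ψ (x) = (1/2) ∑_{y ∼ x} (ψ y - ψ x)`. -/
def rwGenerator : (Torus d N → ℝ) →L[ℝ] (Torus d N → ℝ) :=
  ContinuousLinearMap.pi fun x =>
    (1 / 2 : ℝ) • ∑ y ∈ (torusGraph d N).neighborFinset x,
      (ContinuousLinearMap.proj (R := ℝ) (φ := fun _ : Torus d N => ℝ) y
        - ContinuousLinearMap.proj (R := ℝ) (φ := fun _ : Torus d N => ℝ) x)

/-- The transition semigroup `e^{tL}` of the random walk, `(e^{tL} ψ)(x) = E_x[ψ(X_t)]`. -/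
def rwSemigroup (t : ℝ≥0) : (Torus d N → ℝ) →L[ℝ] (Torus d N → ℝ) :=
  operatorSemigroup (rwGenerator d N) t

/-- The distribution at time `t` of the random walk with initial distribution `ξ`:
`P_ξ(X_t = x) = ∑_y ξ(y) (e^{tL} 1_x)(y)`. -/
def heatFlow (ξ : MassSpace d N) (t : ℝ≥0) (x : Torus d N) : ℝ :=
  ∑ y, ξ.1 y * rwSemigroup d N t (Pi.single x 1) y

/-- The spectral gap of the random walk: the smallest non-zero eigenvalue of `-L`. -/
def spectralGap : ℝ :=
  sInf {l : ℝ | l ≠ 0 ∧ Module.End.HasEigenvalue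
    ((-rwGenerator d N : (Torus d N → ℝ) →L[ℝ] (Torus d N → ℝ)) :
      (Torus d N → ℝ) →ₗ[ℝ] (Torus d N → ℝ)) l}

/-- The relaxation time of the random walk. -/
def relaxationTime : ℝ := 1 / spectralGap d N

/-- `Ξ(t) = N^d exp(-2 t / t_rel) / ((N^{d+2} ∧ t^{d/2+1}) ∨ 1)`. -/
def Xi (t : ℝ≥0) : ℝ :=
  (N : ℝ) ^ d * Real.exp (-2 * (t : ℝ) / relaxationTime d N) /
    max (min ((N : ℝ) ^ (d + 2)) ((t : ℝ) ^ ((d : ℝ) / 2 + 1))) 1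

/-! ### The averaging process -/

variable {d N}

/-- The mass profile obtained from `η` by replacing the values at `x` and `y` by their average. -/
def averageFun (x y : Torus d N) (η : Torus d N → ℝ) (z : Torus d N) : ℝ :=
  if z = x ∨ z = y then (η x + η y) / 2 else η z

theorem averageFun_eq {d N : ℕ} (x y : Torus d N) (η : Torus d N → ℝ) (z : Torus d N) :
    averageFun x y η z = (η z + η (Equiv.swap x y z)) / 2 := by
  unfold averageFun
  by_cases hx : z = x
  · subst hx; simp
  · by_cases hy : z = y
    · subst hy; simp [add_comm]
    · simp [hx, hy, Equiv.swap_apply_of_ne_of_ne]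

theorem averageFun_mem (x y : Torus d N) (η : MassSpace d N) :
    averageFun x y η.1 ∈ stdSimplex ℝ (Torus d N) := by
  refine ⟨fun z => ?_, ?_⟩
  · rw [averageFun_eq]
    have h1 := η.2.1 z
    have h2 := η.2.1 (Equiv.swap x y z)
    positivity
  · simp only [averageFun_eq]
    rw [← Finset.sum_div, Finset.sum_add_distrib, Equiv.sum_comp (Equiv.swap x y) η.1, η.2.2]
    norm_num

/-- The update `η ↦ η^{xy}` as a continuous map of the space of probability mass functions. -/
def averageMap (x y : Torus d N) : C(MassSpace d N, MassSpace d N) where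
  toFun η := ⟨averageFun x y η.1, averageFun_mem x y η⟩
  continuous_toFun := by
    refine Continuous.subtype_mk (continuous_pi fun z => ?_) _
    simp only [averageFun_eq]
    exact (((continuous_apply z).comp continuous_subtype_val).add
      ((continuous_apply (Equiv.swap x y z)).comp continuous_subtype_val)).div_const 2

variable (d N)

/-- The generator of the averaging process, a bounded operator on the continuous functions:
`𝓛 f (η) = (1/2) ∑_x ∑_{y ∼ x} (f(η^{xy}) - f(η))`. -/
def avgGenerator : C(MassSpace d N, ℝ) →L[ℝ] C(MassSpace d N, ℝ) :=
  (1 / 2 : ℝ) • ∑ x, ∑ y ∈ (torusGraph d N).neighborFinset x,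
    (ContinuousMap.compCLM (M := ℝ) ℝ (averageMap x y)
      - ContinuousLinearMap.id ℝ C(MassSpace d N, ℝ))

/-- The transition semigroup `e^{t𝓛}` of the averaging process. -/
def avgSemigroup (t : ℝ≥0) : C(MassSpace d N, ℝ) →L[ℝ] C(MassSpace d N, ℝ) :=
  operatorSemigroup (avgGenerator d N) t

variable {d N}

/-- `η` is an averaging process started from `ξ`, defined on the probability space `(Ω, P)`:
the Markov jump process with values in the space of probability mass functions on the torus,
with generator `avgGenerator d N` and initial state `ξ`. The paths are right-continuous step
functions with finitely many jumps in bounded time intervals, and the Markov property holds with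
respect to the natural filtration. -/
structure IsAveragingProcess {Ω : Type*} [MeasurableSpace Ω] (P : Measure Ω)
    (ξ : MassSpace d N) (η : ℝ≥0 → Ω → MassSpace d N) : Prop where
  isProbabilityMeasure : IsProbabilityMeasure P
  measurable : ∀ t, Measurable (η t)
  initial : ∀ᵐ ω ∂P, η 0 ω = ξ
  jump_paths : ∀ᵐ ω ∂P, ∀ t, (∀ᶠ s in 𝓝[≥] t, η s ω = η t ω) ∧
    ∃ ζ, ∀ᶠ s in 𝓝[<] t, η s ω = ζ
  markov : ∀ (f : C(MassSpace d N, ℝ)) (s t : ℝ≥0), s ≤ t →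
    P[fun ω => f (η t ω) |
        ⨆ r : Set.Iic s, MeasurableSpace.comap (η r.1) inferInstance]
      =ᵐ[P] fun ω => avgSemigroup d N (t - s) f (η s ω)

/-- The mean squared `L²`-distance `E ‖η_t / π - π_t / π‖₂²` at time `t` between a process
`η` and the heat flow from `ξ`, both taken relative to the uniform distribution. -/
def meanSqDeviation {Ω : Type*} [MeasurableSpace Ω] (P : Measure Ω)
    (ξ : MassSpace d N) (η : ℝ≥0 → Ω → MassSpace d N) (t : ℝ≥0) : ℝ :=
  ∫ ω, l2NormSq d N (fun x =>
    (η t ω).1 x / uniformMass d N x - heatFlow d N ξ t x / uniformMass d N x) ∂P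

end

/-! Write `p_t` for the heat kernel, `λ` for the spectral gap, `e` for a unit step and `φ(t) = ((N ∧
√t) ∨ 1)^{-(d+2)}`, so that `Ξ(t) = N^d φ(t) e^{-2λt}` (`Xi_eq`). On linear functionals of `η` the
averaging generator acts as `L`, so `η_t` has mean `p_t`, and the mean squared deviation is `N^d (E
∑ η_t(x)² - p_{2t}(0))`.

Translation invariant quadratic functionals are closed up to one scalar. For an even kernel `k` that
is constant on unit steps, the generator sends `∑ k(x-y) η(x) η(y)` to twice the functional with
kernel `L k`, plus a multiple of the edge energy (`avgGenerator_massForm`). Transporting `k` by the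
heat flow at double speed cancels the first part, and Duhamel's formula (`avgExpectation_massForm`)
expresses the deviation as `N^d · (1/4) ∫ g(t-s) D(s) ds`, where `D` is the expected edge energy and
`g(r) = 2 (p_{2r}(0) - p_{2r}(e))`. The edge energy is itself such a functional, with kernel `-2 L
δ₀`, so `D` solves a scalar renewal equation `D = d g + h * D` with `h = -g'/4`.

Everything now rests on `g`. The heat kernel is a product of one-dimensional kernels, and
trigonometric sums give `g ≍ φ e^{-2λr}` (`gradProfile_bounds`). The renewal kernel is subcritical:
`∫ h ≤ g(0)/4 = 1/2`, and the mass stays below `3/4` after tilting by `e^{ρs}` with `ρ = 2λ -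
N^{-(d+2)}`, once `N` is large. Hence `D` inherits the decay of `g` (`le_of_renewal`,
`exists_renewal_bound`). The loss `N^{-(d+2)}` in the rate compensates for `φ` levelling off at
`N^{-(d+2)}` after time `N²`, where it is no longer integrable; this produces the factor
`exp(Bt/N^{d+2})`, with `B = 1`.

The upper bound follows by convolving `φ` with itself, the lower one from `D ≥ d g` on the interval
`[0, 1 ∧ t]`; both carry the factor `1 ∧ t`. For concentration the exponentials are dropped: `Ξ(t)
e^{t/N^{d+2}} ≤ N^d φ(t)`, which tends to zero when `t ≫ N^{2d/(d+2)}`. -/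

noncomputable section

/-! ### Trigonometric sums -/

/-- The eigenvalues `1 - cos (2πn/N)` of the simple random walk on the cycle of length `N`. -/
def cycleEigenvalue (N n : ℕ) : ℝ := 1 - Real.cos (2 * Real.pi * n / N)

/-- The exponential sum `N⁻¹ ∑ λⁿ exp (-2 r λ)` over the eigenvalues `λ` of the cycle. -/
def spectralMoment (N p : ℕ) (r : ℝ) : ℝ :=
  1 / (N : ℝ) * ∑ n ∈ Finset.range N,
    cycleEigenvalue N n ^ p * Real.exp (-2 * r * cycleEigenvalue N n)

/-- The diffusive length scale `(N ∧ √r) ∨ 1`. -/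
def diffusiveScale (N : ℕ) (r : ℝ) : ℝ := max (min (N : ℝ) √r) 1

theorem cycleEigenvalue_nonneg (N n : ℕ) : 0 ≤ cycleEigenvalue N n :=
  sub_nonneg.2 (Real.cos_le_one _)

theorem cycleEigenvalue_le_two (N n : ℕ) : cycleEigenvalue N n ≤ 2 := by
  have := Real.neg_one_le_cos (2 * Real.pi * n / N)
  unfold cycleEigenvalue; linarith

theorem cycleEigenvalue_zero (N : ℕ) : cycleEigenvalue N 0 = 0 := by simp [cycleEigenvalue]

theorem cycleEigenvalue_sub {N n : ℕ} (hN : 0 < N) (hn : n ≤ N) :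
    cycleEigenvalue N (N - n) = cycleEigenvalue N n := by
  have hN' : (N : ℝ) ≠ 0 := by positivity
  unfold cycleEigenvalue
  rw [Nat.cast_sub hn, mul_sub, sub_div, mul_div_cancel_right₀ _ hN', Real.cos_two_pi_sub]

theorem cycleEigenvalue_le (N n : ℕ) :
    cycleEigenvalue N n ≤ 2 * Real.pi ^ 2 * (n : ℝ) ^ 2 / (N : ℝ) ^ 2 := by
  have h := Real.one_sub_sq_div_two_le_cos (x := 2 * Real.pi * n / N)
  have e : (2 * Real.pi * n / N) ^ 2 / 2 = 2 * Real.pi ^ 2 * (n : ℝ) ^ 2 / (N : ℝ) ^ 2 := by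
    rw [div_pow]; ring
  unfold cycleEigenvalue; linarith

theorem cycleEigenvalue_one_le (N : ℕ) : cycleEigenvalue N 1 ≤ 20 / (N : ℝ) ^ 2 := by
  refine (cycleEigenvalue_le N 1).trans ?_
  gcongr
  have h1 := Real.pi_lt_d2
  have h2 := Real.pi_pos
  push_cast
  nlinarith

theorem le_cycleEigenvalue {N n : ℕ} (hN : 0 < N) (hn : 2 * n ≤ N) :
    8 * (n : ℝ) ^ 2 / (N : ℝ) ^ 2 ≤ cycleEigenvalue N n := by
  have hN' : (0 : ℝ) < N := by positivity
  have hn' : 2 * (n : ℝ) ≤ N := by exact_mod_cast hn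
  have hx : |2 * Real.pi * n / N| ≤ Real.pi := by
    rw [abs_of_nonneg (by positivity), div_le_iff₀ hN']
    nlinarith [Real.pi_pos]
  have h := Real.cos_le_one_sub_mul_cos_sq hx
  have e : 2 / Real.pi ^ 2 * (2 * Real.pi * n / N) ^ 2 = 8 * (n : ℝ) ^ 2 / (N : ℝ) ^ 2 := by
    have := Real.pi_ne_zero
    field_simp; ring
  unfold cycleEigenvalue; linarith

theorem le_cycleEigenvalue_one {N : ℕ} (hN : 2 ≤ N) : 8 / (N : ℝ) ^ 2 ≤ cycleEigenvalue N 1 := by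
  simpa using le_cycleEigenvalue (n := 1) (by omega : 0 < N) (by omega)

theorem cycleEigenvalue_one_le_of_ne {N n : ℕ} (hn : 0 < n) (hnN : n < N) :
    cycleEigenvalue N 1 ≤ cycleEigenvalue N n := by
  have key : ∀ k : ℕ, 0 < k → 2 * k ≤ N → cycleEigenvalue N 1 ≤ cycleEigenvalue N k := by
    intro k hk hkN
    have hN' : (0 : ℝ) < N := by exact_mod_cast (by omega : 0 < N)
    have hk' : 2 * (k : ℝ) ≤ N := by exact_mod_cast hkN
    have hk1 : (1 : ℝ) ≤ k := by exact_mod_cast hk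
    have hpi := Real.pi_pos
    unfold cycleEigenvalue
    refine sub_le_sub_left (Real.cos_le_cos_of_nonneg_of_le_pi (by positivity) ?_ ?_) _
    · rw [div_le_iff₀ hN']; nlinarith
    · gcongr; simpa using hk1
  by_cases h : 2 * n ≤ N
  · exact key n hn h
  · rw [← cycleEigenvalue_sub (by omega) hnN.le]
    exact key _ (by omega) (by omega)

/-- The quadratic lower bound on the eigenvalue holds only up to frequency `N/2`; beyond it the
reflection `n ↦ N - n` applies. Adding the two Gaussians spares later sums the case distinction. -/
theorem exp_neg_cycleEigenvalue_le {N n : ℕ} (hnN : n < N) {c : ℝ} (hc : 0 ≤ c) :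
    Real.exp (-c * cycleEigenvalue N n) ≤
      Real.exp (-(8 * c / (N : ℝ) ^ 2) * (n : ℝ) ^ 2) +
        Real.exp (-(8 * c / (N : ℝ) ^ 2) * ((N : ℝ) - n) ^ 2) := by
  have key : ∀ k : ℕ, 2 * k ≤ N → Real.exp (-c * cycleEigenvalue N k) ≤
      Real.exp (-(8 * c / (N : ℝ) ^ 2) * (k : ℝ) ^ 2) := by
    intro k hk
    refine Real.exp_le_exp.2 ?_
    have h := mul_le_mul_of_nonneg_left (le_cycleEigenvalue (by omega : 0 < N) hk) hc
    have e : c * (8 * (k : ℝ) ^ 2 / (N : ℝ) ^ 2) = 8 * c / (N : ℝ) ^ 2 * (k : ℝ) ^ 2 := by ring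
    linarith
  by_cases h : 2 * n ≤ N
  · exact (key n h).trans (le_add_of_nonneg_right (Real.exp_pos _).le)
  · have := key (N - n) (by omega)
    rw [cycleEigenvalue_sub (by omega) hnN.le, Nat.cast_sub hnN.le] at this
    exact this.trans (le_add_of_nonneg_left (Real.exp_pos _).le)

/-! ### Gaussian sums -/

theorem sum_exp_neg_sq_le (M : ℕ) {a : ℝ} (ha : 0 < a) :
    ∑ n ∈ Finset.range M, Real.exp (-a * ((n : ℝ) + 1) ^ 2) ≤ 1 / √a := by
  have hanti : AntitoneOn (fun x : ℝ => Real.exp (-a * x ^ 2)) (Set.Icc 0 (0 + (M : ℝ))) := by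
    intro x hx y hy hxy
    refine Real.exp_le_exp.2 ?_
    have : x ^ 2 ≤ y ^ 2 := pow_le_pow_left₀ hx.1 hxy 2
    nlinarith
  have h := hanti.sum_le_integral
  have hint : IntegrableOn (fun x : ℝ => Real.exp (-a * x ^ 2)) (Set.Ioi 0) :=
    (integrable_exp_neg_mul_sq ha).integrableOn
  have h2 : ∫ x in (0 : ℝ)..0 + (M : ℝ), Real.exp (-a * x ^ 2) ≤ √(Real.pi / a) / 2 := by
    rw [← integral_gaussian_Ioi, intervalIntegral.integral_of_le (by simp)]
    exact setIntegral_mono_set hint (Eventually.of_forall fun x => (Real.exp_pos _).le)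
      (Set.Ioc_subset_Ioi_self.eventuallyLE)
  have h3 : √(Real.pi / a) / 2 ≤ 1 / √a := by
    rw [Real.sqrt_div Real.pi_pos.le, div_div, mul_comm, ← div_div]
    gcongr
    have : √Real.pi ≤ 2 := by
      rw [Real.sqrt_le_left (by norm_num)]
      linarith [Real.pi_le_four]
    linarith
  have h4 : ∑ n ∈ Finset.range M, Real.exp (-a * ((n : ℝ) + 1) ^ 2) =
      ∑ i ∈ Finset.range M, (fun x : ℝ => Real.exp (-a * x ^ 2)) (0 + ((i + 1 : ℕ) : ℝ)) := by
    simp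
  rw [h4]
  exact h.trans (h2.trans h3)

theorem sum_exp_neg_sq_reflect_le (N : ℕ) {a : ℝ} (ha : 0 < a) :
    ∑ n ∈ Finset.range N, (Real.exp (-a * (n : ℝ) ^ 2) + Real.exp (-a * ((N : ℝ) - n) ^ 2)) ≤
      1 + 2 / √a := by
  rw [Finset.sum_add_distrib]
  have h1 : ∑ n ∈ Finset.range N, Real.exp (-a * (n : ℝ) ^ 2) ≤ 1 + 1 / √a := by
    cases N with
    | zero => simp; positivity
    | succ M =>
      rw [Finset.sum_range_succ']
      have := sum_exp_neg_sq_le M ha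
      simp only [Nat.cast_zero, Nat.cast_add, Nat.cast_one]
      simp only [ne_eq, OfNat.ofNat_ne_zero, not_false_eq_true, zero_pow, mul_zero, Real.exp_zero]
      linarith
  have h2 : ∑ n ∈ Finset.range N, Real.exp (-a * ((N : ℝ) - n) ^ 2) ≤ 1 / √a := by
    refine le_trans (le_of_eq ?_) (sum_exp_neg_sq_le N ha)
    rw [← Finset.sum_range_reflect]
    refine Finset.sum_congr rfl fun n hn => ?_
    have hn := Finset.mem_range.1 hn
    have e : ((N - 1 - n : ℕ) : ℝ) = N - 1 - n := by
      rw [Nat.cast_sub (by omega), Nat.cast_sub (by omega)]; simp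
    rw [e]
    ring_nf
  have e : 2 / √a = 1 / √a + 1 / √a := by ring
  linarith

/-! ### The diffusive length scale -/

theorem one_le_diffusiveScale (N : ℕ) (r : ℝ) : 1 ≤ diffusiveScale N r := le_max_right _ _

theorem diffusiveScale_pos (N : ℕ) (r : ℝ) : 0 < diffusiveScale N r :=
  one_pos.trans_le (one_le_diffusiveScale N r)

theorem diffusiveScale_le {N : ℕ} (hN : 1 ≤ N) (r : ℝ) : diffusiveScale N r ≤ N :=
  max_le (min_le_left _ _) (by exact_mod_cast hN)

theorem diffusiveScale_le_sqrt (N : ℕ) {r : ℝ} (hr : 1 ≤ r) : diffusiveScale N r ≤ √r :=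
  max_le (min_le_right _ _) (Real.one_le_sqrt.2 hr)

theorem diffusiveScale_eq_one (N : ℕ) {r : ℝ} (hr : r ≤ 1) : diffusiveScale N r = 1 :=
  max_eq_right ((min_le_right _ _).trans (Real.sqrt_le_one.2 hr))

theorem diffusiveScale_eq {N : ℕ} (hN : 1 ≤ N) {r : ℝ} (hr : N ≤ √r) : diffusiveScale N r = N := by
  rw [diffusiveScale, min_eq_left hr, max_eq_left (by exact_mod_cast hN)]

theorem le_sq_diffusiveScale {N : ℕ} {r : ℝ} (hr0 : 0 ≤ r) (hr : √r ≤ N) :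
    r ≤ diffusiveScale N r ^ 2 := by
  have h : √r ≤ diffusiveScale N r := by
    rw [diffusiveScale, min_eq_right hr]; exact le_max_left _ _
  calc r = √r ^ 2 := (Real.sq_sqrt hr0).symm
    _ ≤ _ := by gcongr

/-! ### Two-sided bounds for the exponential sums -/

theorem spectralMoment_nonneg (N p : ℕ) (r : ℝ) : 0 ≤ spectralMoment N p r := by
  unfold spectralMoment
  have := cycleEigenvalue_nonneg N
  exact mul_nonneg (by positivity) (Finset.sum_nonneg fun n _ =>
    mul_nonneg (pow_nonneg (this n) p) (Real.exp_pos _).le)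

theorem spectralMoment_succ_le (N p : ℕ) (r : ℝ) :
    spectralMoment N (p + 1) r ≤ 2 * spectralMoment N p r := by
  unfold spectralMoment
  rw [mul_left_comm 2, Finset.mul_sum _ _ (2 : ℝ)]
  refine mul_le_mul_of_nonneg_left (Finset.sum_le_sum fun n _ => ?_)
    (by positivity : (0 : ℝ) ≤ 1 / N)
  have h1 := cycleEigenvalue_nonneg N n
  have h2 := cycleEigenvalue_le_two N n
  have h3 : 0 ≤ cycleEigenvalue N n ^ p * Real.exp (-2 * r * cycleEigenvalue N n) := by positivity
  rw [pow_succ]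
  nlinarith

theorem hasDerivAt_spectralMoment (N p : ℕ) (r : ℝ) :
    HasDerivAt (spectralMoment N p) (-2 * spectralMoment N (p + 1) r) r := by
  unfold spectralMoment
  have h : HasDerivAt (fun r : ℝ => ∑ n ∈ Finset.range N,
      cycleEigenvalue N n ^ p * Real.exp (-2 * r * cycleEigenvalue N n))
      (∑ n ∈ Finset.range N, cycleEigenvalue N n ^ p *
        (Real.exp (-2 * r * cycleEigenvalue N n) * (-2 * 1 * cycleEigenvalue N n))) r :=
    HasDerivAt.fun_sum fun n _ =>
      ((((hasDerivAt_id r).const_mul (-2)).mul_const _).exp.const_mul _)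
  refine (h.const_mul (1 / (N : ℝ))).congr_deriv ?_
  rw [mul_left_comm (-2), Finset.mul_sum (Finset.range N) _ (-2 : ℝ)]
  congr 1
  refine Finset.sum_congr rfl fun n _ => ?_
  ring

theorem antitone_spectralMoment (N p : ℕ) : Antitone (spectralMoment N p) :=
  antitone_of_deriv_nonpos (fun r => (hasDerivAt_spectralMoment N p r).differentiableAt)
    fun r => by
      rw [(hasDerivAt_spectralMoment N p r).deriv]
      linarith [spectralMoment_nonneg N (p + 1) r]

theorem spectralMoment_zero_zero {N : ℕ} (hN : 1 ≤ N) : spectralMoment N 0 0 = 1 := by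
  have : (N : ℝ) ≠ 0 := by positivity
  simp [spectralMoment, this]

theorem spectralMoment_zero_le {N : ℕ} (hN : 1 ≤ N) {r : ℝ} (hr : 0 ≤ r) :
    spectralMoment N 0 r ≤ 2 / diffusiveScale N r := by
  have hN' : (0 : ℝ) < N := by positivity
  rcases le_total r 1 with h1 | h1
  · rw [diffusiveScale_eq_one N h1]
    refine (antitone_spectralMoment N 0 hr).trans ?_
    rw [spectralMoment_zero_zero hN]; norm_num
  · have hr0 : 0 < r := by linarith
    have hs : 0 < √r := Real.sqrt_pos.2 hr0
    have hm := diffusiveScale_pos N r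
    have hsum : ∑ n ∈ Finset.range N, cycleEigenvalue N n ^ 0 *
        Real.exp (-2 * r * cycleEigenvalue N n) ≤ 1 + 2 / √(8 * (2 * r) / (N : ℝ) ^ 2) := by
      refine le_trans (Finset.sum_le_sum fun n hn => ?_)
        (sum_exp_neg_sq_reflect_le N (a := 8 * (2 * r) / (N : ℝ) ^ 2) (by positivity))
      have := exp_neg_cycleEigenvalue_le (Finset.mem_range.1 hn) (c := 2 * r) (by positivity)
      simpa using this
    have e : √(8 * (2 * r) / (N : ℝ) ^ 2) = 4 * √r / N := by
      rw [Real.sqrt_div (by positivity), Real.sqrt_sq hN'.le,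
        show 8 * (2 * r) = 4 ^ 2 * r by ring, Real.sqrt_mul (by positivity), Real.sqrt_sq (by norm_num)]
    rw [e] at hsum
    calc spectralMoment N 0 r ≤ 1 / (N : ℝ) * (1 + 2 / (4 * √r / N)) := by
          unfold spectralMoment; gcongr
      _ = 1 / N + 1 / 2 * (1 / √r) := by field_simp; ring
      _ ≤ 1 / diffusiveScale N r + 1 / 2 * (1 / diffusiveScale N r) := by
          gcongr
          · exact diffusiveScale_le hN r
          · exact diffusiveScale_le_sqrt N h1
      _ ≤ 2 / diffusiveScale N r := by
          have : 0 < 1 / diffusiveScale N r := by positivity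
          have e : 2 / diffusiveScale N r = 2 * (1 / diffusiveScale N r) := by ring
          linarith

theorem le_spectralMoment_zero {N : ℕ} (hN : 1 ≤ N) {r : ℝ} (hr : 0 ≤ r) :
    Real.exp (-4 * Real.pi ^ 2) / diffusiveScale N r ≤ spectralMoment N 0 r := by
  have hN' : (0 : ℝ) < N := by positivity
  have hm := diffusiveScale_pos N r
  set m := diffusiveScale N r with hmdef
  rcases le_total (N : ℝ) √r with h | h
  · rw [hmdef, diffusiveScale_eq hN h]
    have h0 : Real.exp (-4 * Real.pi ^ 2) ≤ 1 := Real.exp_le_one_iff.2 (by nlinarith [Real.pi_pos])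
    unfold spectralMoment
    rw [div_eq_mul_one_div, mul_comm]
    refine mul_le_mul_of_nonneg_left (h0.trans ?_) (by positivity)
    have := Finset.single_le_sum (f := fun n => cycleEigenvalue N n ^ 0 *
      Real.exp (-2 * r * cycleEigenvalue N n)) (s := Finset.range N)
      (fun n _ => by simpa using (Real.exp_pos _).le) (Finset.mem_range.2 hN)
    simpa [cycleEigenvalue_zero] using this
  · have hrm : r ≤ m ^ 2 := le_sq_diffusiveScale hr h
    set J : ℕ := ⌈(N : ℝ) / m⌉₊ with hJ
    -- All frequencies below `N/m` satisfy `r λ ≤ 2π²`, so each contributes a constant, and there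
    -- are at least `N/m` of them.
    have hJN : J ≤ N := by
      rw [hJ, Nat.ceil_le]
      exact div_le_self hN'.le (one_le_diffusiveScale N r)
    have hterm : ∀ n ∈ Finset.range J, Real.exp (-4 * Real.pi ^ 2) ≤
        cycleEigenvalue N n ^ 0 * Real.exp (-2 * r * cycleEigenvalue N n) := by
      intro n hn
      have hn1 : (n : ℝ) < N / m := Nat.lt_ceil.1 (Finset.mem_range.1 hn)
      have hn2 : (n : ℝ) * m ≤ N := ((lt_div_iff₀ hm).1 hn1).le
      rw [pow_zero, one_mul, Real.exp_le_exp]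
      have h1 : r * cycleEigenvalue N n ≤ m ^ 2 * (2 * Real.pi ^ 2 * (n : ℝ) ^ 2 / (N : ℝ) ^ 2) :=
        mul_le_mul hrm (cycleEigenvalue_le N n) (cycleEigenvalue_nonneg N n) (by positivity)
      have h2 : m ^ 2 * (2 * Real.pi ^ 2 * (n : ℝ) ^ 2 / (N : ℝ) ^ 2) ≤ 2 * Real.pi ^ 2 := by
        rw [← mul_div_assoc, div_le_iff₀ (by positivity)]
        have : ((n : ℝ) * m) ^ 2 ≤ (N : ℝ) ^ 2 := by gcongr
        nlinarith [mul_le_mul_of_nonneg_left this (by positivity : 0 ≤ 2 * Real.pi ^ 2)]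
      nlinarith
    have hsum : (N : ℝ) / m * Real.exp (-4 * Real.pi ^ 2) ≤ ∑ n ∈ Finset.range N,
        cycleEigenvalue N n ^ 0 * Real.exp (-2 * r * cycleEigenvalue N n) := by
      calc (N : ℝ) / m * Real.exp (-4 * Real.pi ^ 2) ≤ J * Real.exp (-4 * Real.pi ^ 2) := by
            gcongr; exact Nat.le_ceil _
        _ = ∑ n ∈ Finset.range J, Real.exp (-4 * Real.pi ^ 2) := by simp
        _ ≤ _ := Finset.sum_le_sum hterm
        _ ≤ _ := Finset.sum_le_sum_of_subset_of_nonneg (Finset.range_mono hJN)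
            fun n _ _ => by simpa using (Real.exp_pos _).le
    calc Real.exp (-4 * Real.pi ^ 2) / m = 1 / (N : ℝ) * (N / m * Real.exp (-4 * Real.pi ^ 2)) := by
          field_simp
      _ ≤ _ := by unfold spectralMoment; gcongr

theorem mul_exp_neg_le {c x : ℝ} (hc : 0 < c) : x * Real.exp (-c * x) ≤ 1 / c := by
  have h := Real.add_one_le_exp (c * x)
  have h2 : Real.exp (-c * x) = (Real.exp (c * x))⁻¹ := by rw [← Real.exp_neg]; ring_nf
  rw [h2, ← div_eq_mul_inv, div_le_div_iff₀ (Real.exp_pos _) hc]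
  nlinarith

/-- Factoring out the exact rate of the gap leaves the two lowest modes `1` and `N - 1` undamped,
each of size `O(N⁻²)`. Every other nonzero mode has eigenvalue at least `8/5` of the gap, so its
excess over the gap is comparable to the eigenvalue itself. -/
theorem spectralMoment_one_term_le {N n : ℕ} (hN : 4 ≤ N) (hnN : n < N) {r : ℝ} (hr : 0 < r) :
    cycleEigenvalue N n * Real.exp (-2 * r * (cycleEigenvalue N n - cycleEigenvalue N 1)) ≤
      ((if n = 1 then 20 / (N : ℝ) ^ 2 else 0) + if n = N - 1 then 20 / (N : ℝ) ^ 2 else 0) +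
      3 / r * (Real.exp (-(3 * r / (N : ℝ) ^ 2) * (n : ℝ) ^ 2) +
        Real.exp (-(3 * r / (N : ℝ) ^ 2) * ((N : ℝ) - n) ^ 2)) := by
  have hN' : (0 : ℝ) < N := by exact_mod_cast (by omega : 0 < N)
  have hpos : 0 ≤ 3 / r * (Real.exp (-(3 * r / (N : ℝ) ^ 2) * (n : ℝ) ^ 2) +
        Real.exp (-(3 * r / (N : ℝ) ^ 2) * ((N : ℝ) - n) ^ 2)) := by positivity
  have hc : 0 ≤ 20 / (N : ℝ) ^ 2 := by positivity
  have hl1 := cycleEigenvalue_one_le N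
  rcases Nat.eq_zero_or_pos n with h0 | h0
  · subst h0
    rw [cycleEigenvalue_zero, zero_mul]
    refine add_nonneg (add_nonneg ?_ ?_) hpos <;> split_ifs <;> first | exact hc | exact le_rfl
  by_cases h1 : n = 1
  · subst h1
    rw [if_pos rfl, if_neg (by omega)]
    simp only [sub_self, mul_zero, Real.exp_zero, mul_one]
    linarith
  by_cases h2 : n = N - 1
  · have e : cycleEigenvalue N n = cycleEigenvalue N 1 := by
      rw [h2, cycleEigenvalue_sub (by omega) (by omega)]
    rw [if_neg h1, if_pos h2, e]
    simp only [sub_self, mul_zero, Real.exp_zero, mul_one]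
    linarith
  rw [if_neg h1, if_neg h2, add_zero, zero_add]
  set l := cycleEigenvalue N n with hl
  have hl0 : 0 ≤ l := cycleEigenvalue_nonneg N n
  have hlow : 32 / (N : ℝ) ^ 2 ≤ l := by
    have key : ∀ k : ℕ, 2 ≤ k → 2 * k ≤ N → 32 / (N : ℝ) ^ 2 ≤ cycleEigenvalue N k := by
      intro k hk hkN
      refine le_trans ?_ (le_cycleEigenvalue (by omega : 0 < N) hkN)
      have : (2 : ℝ) ≤ k := by exact_mod_cast hk
      gcongr
      nlinarith
    by_cases h : 2 * n ≤ N
    · exact key n (by omega) h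
    · rw [hl, ← cycleEigenvalue_sub (by omega) hnN.le]
      exact key _ (by omega) (by omega)
  have hgap : 5 / 8 * l ≥ cycleEigenvalue N 1 := by
    have e : 20 / (N : ℝ) ^ 2 = 5 / 8 * (32 / (N : ℝ) ^ 2) := by ring
    linarith
  have hexp := exp_neg_cycleEigenvalue_le hnN (c := 3 / 8 * r) (by positivity)
  rw [show 8 * (3 / 8 * r) = 3 * r by ring] at hexp
  have hmul := mul_exp_neg_le (c := 3 / 8 * r) (x := l) (by positivity)
  have h3 : 1 / (3 / 8 * r) ≤ 3 / r := by
    rw [div_le_div_iff₀ (by positivity) hr]; linarith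
  -- The available exponent `3/4 · r l` is split in half: one half absorbs the factor `l` at the
  -- price `3/r`, the other supplies the Gaussian.
  calc l * Real.exp (-2 * r * (l - cycleEigenvalue N 1))
      ≤ l * Real.exp (-(3 / 8 * r) * l + -(3 / 8 * r) * l) := by
        gcongr
        nlinarith
    _ = (l * Real.exp (-(3 / 8 * r) * l)) * Real.exp (-(3 / 8 * r) * l) := by
        rw [Real.exp_add]; ring
    _ ≤ 3 / r * _ := mul_le_mul (hmul.trans h3) hexp (Real.exp_pos _).le (by positivity)

theorem exp_mul_spectralMoment_one (N : ℕ) (r : ℝ) :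
    Real.exp (2 * cycleEigenvalue N 1 * r) * spectralMoment N 1 r =
      1 / (N : ℝ) * ∑ n ∈ Finset.range N, cycleEigenvalue N n *
        Real.exp (-2 * r * (cycleEigenvalue N n - cycleEigenvalue N 1)) := by
  unfold spectralMoment
  rw [mul_left_comm, Finset.mul_sum]
  congr 1
  refine Finset.sum_congr rfl fun n _ => ?_
  rw [pow_one, mul_left_comm, ← Real.exp_add]
  ring_nf

theorem spectralMoment_one_le {N : ℕ} (hN : 4 ≤ N) {r : ℝ} (hr : 0 ≤ r) :
    Real.exp (2 * cycleEigenvalue N 1 * r) * spectralMoment N 1 r ≤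
      (47 + 2 * Real.exp 4) / diffusiveScale N r ^ 3 := by
  have hN' : (0 : ℝ) < N := by exact_mod_cast (by omega : 0 < N)
  have hm := diffusiveScale_pos N r
  rcases le_total r 1 with h1 | h1
  · rw [diffusiveScale_eq_one N h1, one_pow, div_one]
    have h2 : spectralMoment N 1 r ≤ 2 := by
      refine (antitone_spectralMoment N 1 hr).trans ((spectralMoment_succ_le N 0 0).trans ?_)
      rw [spectralMoment_zero_zero (by omega)]; norm_num
    have h3 : Real.exp (2 * cycleEigenvalue N 1 * r) ≤ Real.exp 4 := by
      rw [Real.exp_le_exp]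
      nlinarith [cycleEigenvalue_le_two N 1, cycleEigenvalue_nonneg N 1]
    have h4 := mul_le_mul h3 h2 (spectralMoment_nonneg N 1 r) (Real.exp_pos 4).le
    linarith
  · have hr0 : 0 < r := by linarith
    have hs : 0 < √r := Real.sqrt_pos.2 hr0
    have hsum : ∑ n ∈ Finset.range N, cycleEigenvalue N n *
        Real.exp (-2 * r * (cycleEigenvalue N n - cycleEigenvalue N 1)) ≤
        (20 / (N : ℝ) ^ 2 + 20 / (N : ℝ) ^ 2) + 3 / r * (1 + 2 / √(3 * r / (N : ℝ) ^ 2)) := by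
      refine (Finset.sum_le_sum fun n hn =>
        spectralMoment_one_term_le hN (Finset.mem_range.1 hn) hr0).trans ?_
      rw [Finset.sum_add_distrib, Finset.sum_add_distrib, ← Finset.mul_sum]
      gcongr
      · rw [Finset.sum_ite_eq' , if_pos (Finset.mem_range.2 (by omega))]
      · rw [Finset.sum_ite_eq' , if_pos (Finset.mem_range.2 (by omega))]
      · exact sum_exp_neg_sq_reflect_le N (by positivity)
    have e : 3 / 2 * √r / N ≤ √(3 * r / (N : ℝ) ^ 2) := by
      rw [Real.sqrt_div (by positivity), Real.sqrt_sq hN'.le, Real.sqrt_mul (by positivity)]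
      gcongr
      rw [Real.le_sqrt (by norm_num) (by norm_num)]
      norm_num
    have hr2 : 1 / r = (1 / √r) ^ 2 := by rw [div_pow, one_pow, Real.sq_sqrt hr]
    have hi1 : 1 / (N : ℝ) ≤ 1 / diffusiveScale N r := by
      gcongr; exact diffusiveScale_le (by omega) r
    have hi2 : 1 / √r ≤ 1 / diffusiveScale N r := by
      gcongr; exact diffusiveScale_le_sqrt N h1
    rw [exp_mul_spectralMoment_one]
    calc _ ≤ 1 / (N : ℝ) * ((20 / (N : ℝ) ^ 2 + 20 / (N : ℝ) ^ 2) +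
          3 / r * (1 + 2 / (3 / 2 * √r / N))) := by
          refine mul_le_mul_of_nonneg_left (hsum.trans ?_) (by positivity)
          gcongr
      _ = 40 * (1 / (N : ℝ)) ^ 3 + 3 * (1 / N) * (1 / √r) ^ 2 + 4 * (1 / √r) ^ 3 := by
          rw [show 3 / r = 3 * (1 / r) by ring, hr2]
          field_simp
          ring
      _ ≤ 40 * (1 / diffusiveScale N r) ^ 3 +
          3 * (1 / diffusiveScale N r) * (1 / diffusiveScale N r) ^ 2 +
          4 * (1 / diffusiveScale N r) ^ 3 := by gcongr
      _ = 47 / diffusiveScale N r ^ 3 := by field_simp; norm_num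
      _ ≤ _ := by
          gcongr
          linarith [Real.exp_pos 4]

theorem sum_sq_ge (n : ℕ) : (n : ℝ) ^ 3 / 3 ≤ ∑ k ∈ Finset.range n, ((k : ℝ) + 1) ^ 2 := by
  induction n with
  | zero => simp
  | succ n ih =>
    rw [Finset.sum_range_succ]
    push_cast
    nlinarith [(Nat.cast_nonneg n : (0 : ℝ) ≤ n)]

theorem le_spectralMoment_one {N : ℕ} (hN : 2 ≤ N) {r : ℝ} (hr : 0 ≤ r) :
    Real.exp (-Real.pi ^ 2) / 24 / diffusiveScale N r ^ 3 ≤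
      Real.exp (2 * cycleEigenvalue N 1 * r) * spectralMoment N 1 r := by
  have hN' : (0 : ℝ) < N := by exact_mod_cast (by omega : 0 < N)
  have hm := diffusiveScale_pos N r
  have he1 : Real.exp (-Real.pi ^ 2) ≤ 1 :=
    Real.exp_le_one_iff.2 (by nlinarith [Real.pi_pos])
  set m := diffusiveScale N r with hmdef
  rcases le_total (N : ℝ) (2 * m) with h | h
  -- Here the scale is comparable to `N`, and the mode `n = 1`, not damped after the factorisation,
  -- suffices alone.
  · rw [exp_mul_spectralMoment_one]
    have h1 := Finset.single_le_sum (f := fun n => cycleEigenvalue N n *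
        Real.exp (-2 * r * (cycleEigenvalue N n - cycleEigenvalue N 1))) (s := Finset.range N)
      (fun n _ => mul_nonneg (cycleEigenvalue_nonneg N n) (Real.exp_pos _).le)
      (Finset.mem_range.2 (by omega : 1 < N))
    simp only [sub_self, mul_zero, Real.exp_zero, mul_one] at h1
    have h2 := (le_cycleEigenvalue_one hN).trans h1
    calc Real.exp (-Real.pi ^ 2) / 24 / m ^ 3 ≤ 1 / m ^ 3 := by gcongr; linarith
      _ = 8 / (2 * m) ^ 3 := by field_simp; norm_num
      _ ≤ 8 / (N : ℝ) ^ 3 := by gcongr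
      _ = 1 / (N : ℝ) * (8 / (N : ℝ) ^ 2) := by field_simp
      _ ≤ _ := by gcongr
  · have hmN : √r ≤ N := by
      by_contra hcon
      have := diffusiveScale_eq (by omega : 1 ≤ N) (not_le.1 hcon).le
      rw [← hmdef] at this
      linarith
    have hrm : r ≤ m ^ 2 := le_sq_diffusiveScale hr hmN
    have hJ1 : 1 ≤ (N : ℝ) / (2 * m) := by rwa [one_le_div (by positivity)]
    -- Modes up to `N/(2m)` are damped by at most a constant and lie in the range of the quadratic
    -- lower bound; the sum of their eigenvalues is of order `J³/N²`.
    set J : ℕ := ⌊(N : ℝ) / (2 * m)⌋₊ with hJ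
    have hJle : (J : ℝ) ≤ N / (2 * m) := Nat.floor_le (by positivity)
    have hJge : (N : ℝ) / (2 * m) / 2 ≤ J := by
      have h1 := Nat.lt_floor_add_one ((N : ℝ) / (2 * m))
      rw [← hJ] at h1
      have h2 : 1 ≤ J := by rw [hJ]; exact Nat.le_floor (by simpa using hJ1)
      have h3 : (1 : ℝ) ≤ J := by exact_mod_cast h2
      linarith
    have hJ2 : 2 * (J : ℝ) * m ≤ N := by
      have := (le_div_iff₀ (by positivity : 0 < 2 * m)).1 hJle
      linarith
    have hJN : 2 * J ≤ N := by
      have : 2 * (J : ℝ) ≤ N := by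
        have h1 : 1 ≤ m := one_le_diffusiveScale N r
        nlinarith [(Nat.cast_nonneg J : (0 : ℝ) ≤ J)]
      exact_mod_cast this
    have hterm : ∀ k ∈ Finset.range J, Real.exp (-Real.pi ^ 2) * (8 / (N : ℝ) ^ 2) * ((k : ℝ) + 1) ^ 2 ≤
        cycleEigenvalue N (k + 1) ^ 1 * Real.exp (-2 * r * cycleEigenvalue N (k + 1)) := by
      intro k hk
      have hk' := Finset.mem_range.1 hk
      have hkJ : ((k + 1 : ℕ) : ℝ) ≤ J := by exact_mod_cast hk'
      have h1 := le_cycleEigenvalue (by omega : 0 < N) (by omega : 2 * (k + 1) ≤ N)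
      have h2 := cycleEigenvalue_le N (k + 1)
      have h3 : 2 * ((k + 1 : ℕ) : ℝ) * m ≤ N := by
        refine le_trans ?_ hJ2
        gcongr
      have h4 : r * cycleEigenvalue N (k + 1) ≤ Real.pi ^ 2 / 2 := by
        calc r * cycleEigenvalue N (k + 1)
            ≤ m ^ 2 * (2 * Real.pi ^ 2 * ((k + 1 : ℕ) : ℝ) ^ 2 / (N : ℝ) ^ 2) :=
              mul_le_mul hrm h2 (cycleEigenvalue_nonneg _ _) (by positivity)
          _ = Real.pi ^ 2 / 2 * ((2 * ((k + 1 : ℕ) : ℝ) * m) ^ 2 / (N : ℝ) ^ 2) := by ring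
          _ ≤ Real.pi ^ 2 / 2 * 1 := by
              gcongr
              rw [div_le_one (by positivity)]
              gcongr
          _ = _ := mul_one _
      calc Real.exp (-Real.pi ^ 2) * (8 / (N : ℝ) ^ 2) * ((k : ℝ) + 1) ^ 2
          = 8 * ((k + 1 : ℕ) : ℝ) ^ 2 / (N : ℝ) ^ 2 * Real.exp (-Real.pi ^ 2) := by
            push_cast; ring
        _ ≤ cycleEigenvalue N (k + 1) * Real.exp (-2 * r * cycleEigenvalue N (k + 1)) := by
            gcongr
            · exact cycleEigenvalue_nonneg _ _
            · linarith
        _ = _ := by rw [pow_one]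
    have hsum : Real.exp (-Real.pi ^ 2) * (8 / (N : ℝ) ^ 2) * ((N / (2 * m) / 2) ^ 3 / 3) ≤
        ∑ n ∈ Finset.range N,
        cycleEigenvalue N n ^ 1 * Real.exp (-2 * r * cycleEigenvalue N n) := by
      calc _ ≤ Real.exp (-Real.pi ^ 2) * (8 / (N : ℝ) ^ 2) * ((J : ℝ) ^ 3 / 3) := by gcongr
        _ ≤ Real.exp (-Real.pi ^ 2) * (8 / (N : ℝ) ^ 2) *
            ∑ k ∈ Finset.range J, ((k : ℝ) + 1) ^ 2 := by gcongr; exact sum_sq_ge J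
        _ ≤ ∑ k ∈ Finset.range J, cycleEigenvalue N (k + 1) ^ 1 *
              Real.exp (-2 * r * cycleEigenvalue N (k + 1)) := by
            rw [Finset.mul_sum]; exact Finset.sum_le_sum hterm
        _ ≤ ∑ n ∈ Finset.range (J + 1),
            cycleEigenvalue N n ^ 1 * Real.exp (-2 * r * cycleEigenvalue N n) := by
            rw [Finset.sum_range_succ' _ J]
            simp [cycleEigenvalue_zero]
        _ ≤ _ := Finset.sum_le_sum_of_subset_of_nonneg (Finset.range_mono (by omega))
            fun n _ _ => mul_nonneg (pow_nonneg (cycleEigenvalue_nonneg N n) 1) (Real.exp_pos _).le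
    have hexp : 1 ≤ Real.exp (2 * cycleEigenvalue N 1 * r) :=
      Real.one_le_exp (mul_nonneg (mul_nonneg zero_le_two (cycleEigenvalue_nonneg N 1)) hr)
    have hA : Real.exp (-Real.pi ^ 2) / 24 / m ^ 3 ≤ spectralMoment N 1 r := by
      calc Real.exp (-Real.pi ^ 2) / 24 / m ^ 3 = 1 / (N : ℝ) *
          (Real.exp (-Real.pi ^ 2) * (8 / (N : ℝ) ^ 2) * ((N / (2 * m) / 2) ^ 3 / 3)) := by
            field_simp; norm_num
        _ ≤ _ := by unfold spectralMoment; gcongr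
    exact hA.trans (le_mul_of_one_le_left (spectralMoment_nonneg N 1 r) hexp)

/-! ### Renewal equations -/

/-- Fubini on the triangle `s ≤ t`: for fixed `s` the inner integral is the mass of `H` on `[0, T -
s]`. Positivity of `H` plays no role. -/
theorem integral_convolution_le {D H : ℝ → ℝ} (hDc : Continuous D) (hHc : Continuous H)
    (hD : ∀ t, 0 ≤ t → 0 ≤ D t) {q : ℝ} (hHi : ∀ t, 0 ≤ t → ∫ s in (0 : ℝ)..t, H s ≤ q)
    {T : ℝ} (hT : 0 ≤ T) :
    ∫ t in (0 : ℝ)..T, ∫ s in (0 : ℝ)..t, H (t - s) * D s ≤ q * ∫ s in (0 : ℝ)..T, D s := by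
  set F : ℝ → ℝ → ℝ := fun t s => if s ≤ t then H (t - s) * D s else 0 with hF
  have hcont : Continuous fun p : ℝ × ℝ => H (p.1 - p.2) * D p.2 := by fun_prop
  have hFint : Integrable (Function.uncurry F)
      ((volume.restrict (Set.uIoc 0 T)).prod (volume.restrict (Set.uIoc 0 T))) := by
    rw [Measure.prod_restrict]
    have h1 : IntegrableOn (fun p : ℝ × ℝ => H (p.1 - p.2) * D p.2)
        (Set.Icc 0 T ×ˢ Set.Icc 0 T) (volume.prod volume) :=
      hcont.continuousOn.integrableOn_compact (isCompact_Icc.prod isCompact_Icc)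
    have h2 : IntegrableOn (fun p : ℝ × ℝ => H (p.1 - p.2) * D p.2)
        (Set.uIoc 0 T ×ˢ Set.uIoc 0 T) (volume.prod volume) := by
      refine h1.mono_set ?_
      rw [Set.uIoc_of_le hT]
      exact Set.prod_mono Set.Ioc_subset_Icc_self Set.Ioc_subset_Icc_self
    have h3 := h2.indicator (measurableSet_le (measurable_snd (α := ℝ) (β := ℝ)) measurable_fst)
    refine h3.congr (Eventually.of_forall fun p => ?_)
    simp only [Set.indicator, Function.uncurry, hF, Set.mem_ofPred_eq]
  have hswap := intervalIntegral_intervalIntegral_swap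
    (by rwa [Measure.prod_restrict, ← Measure.volume_eq_prod] at hFint)
  have hleft : ∀ t ∈ Set.uIcc 0 T, ∫ s in (0 : ℝ)..T, F t s = ∫ s in (0 : ℝ)..t, H (t - s) * D s := by
    intro t ht
    rw [Set.uIcc_of_le hT] at ht
    have e : (fun s => F t s) = (Set.Iic t).indicator fun s => H (t - s) * D s := by
      ext s; simp [F, Set.indicator]
    rw [e, intervalIntegral.integral_of_le hT, setIntegral_indicator measurableSet_Iic,
      intervalIntegral.integral_of_le ht.1]
    congr 2
    ext s
    simp only [Set.mem_inter_iff, Set.mem_Ioc, Set.mem_Iic]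
    exact ⟨fun h => ⟨h.1.1, h.2⟩, fun h => ⟨⟨h.1, h.2.trans ht.2⟩, h.2⟩⟩
  have hright : ∀ s ∈ Set.Icc 0 T, ∫ t in (0 : ℝ)..T, F t s ≤ q * D s := by
    intro s hs
    have e : (fun t => F t s) = (Set.Ici s).indicator fun t => H (t - s) * D s := by
      ext t; simp [F, Set.indicator]
    have e2 : ∫ t in (0 : ℝ)..T, F t s = ∫ t in s..T, H (t - s) * D s := by
      rw [e, intervalIntegral.integral_of_le hT, setIntegral_indicator measurableSet_Ici,
        intervalIntegral.integral_of_le hs.2, ← integral_Icc_eq_integral_Ioc]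
      refine setIntegral_congr_set ?_
      have : (Set.Icc s T : Set ℝ) =ᵐ[volume] (Set.Ioc 0 T ∩ Set.Ici s : Set ℝ) := by
        rcases hs.1.eq_or_lt with h0 | h0
        · subst h0
          have h1 : Set.Ioc 0 T ∩ Set.Ici (0 : ℝ) = Set.Ioc 0 T :=
            Set.inter_eq_left.2 fun x hx => hx.1.le
          rw [h1]; exact Ioc_ae_eq_Icc.symm
        · have h1 : Set.Ioc 0 T ∩ Set.Ici s = Set.Icc s T := by
            ext x
            simp only [Set.mem_inter_iff, Set.mem_Ioc, Set.mem_Ici, Set.mem_Icc]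
            exact ⟨fun h => ⟨h.2, h.1.2⟩, fun h => ⟨⟨h0.trans_le h.1, h.2⟩, h.1⟩⟩
          rw [h1]
          exact EventuallyEq.rfl
      exact this.symm
    rw [e2, intervalIntegral.integral_mul_const,
      intervalIntegral.integral_comp_sub_right (fun t => H t) s, sub_self]
    exact mul_le_mul_of_nonneg_right (hHi _ (by linarith [hs.2])) (hD s hs.1)
  calc ∫ t in (0 : ℝ)..T, ∫ s in (0 : ℝ)..t, H (t - s) * D s
      = ∫ t in (0 : ℝ)..T, ∫ s in (0 : ℝ)..T, F t s :=
        (intervalIntegral.integral_congr hleft).symm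
    _ = ∫ s in (0 : ℝ)..T, ∫ t in (0 : ℝ)..T, F t s := hswap
    _ ≤ ∫ s in (0 : ℝ)..T, q * D s := by
        refine intervalIntegral.integral_mono_on hT ?_ ((hDc.const_mul q).intervalIntegrable _ _) hright
        rw [intervalIntegrable_iff]
        refine hFint.integral_prod_right.congr (Eventually.of_forall fun s => ?_)
        rw [Set.uIoc_of_le hT]
        exact (intervalIntegral.integral_of_le hT).symm
    _ = _ := intervalIntegral.integral_const_mul _ _

/-- Integrating the equation gives `∫ D ≤ C + (3/4) ∫ D`, and the last term is absorbed. -/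
theorem integral_le_of_renewal {D G H : ℝ → ℝ} (hDc : Continuous D) (hGc : Continuous G)
    (hHc : Continuous H) (hD : ∀ t, 0 ≤ t → 0 ≤ D t)
    (heq : ∀ t, 0 ≤ t → D t = G t + ∫ s in (0 : ℝ)..t, H (t - s) * D s)
    (hHi : ∀ t, 0 ≤ t → ∫ s in (0 : ℝ)..t, H s ≤ 3 / 4)
    {C : ℝ} (hGi : ∀ t, 0 ≤ t → ∫ s in (0 : ℝ)..t, G s ≤ C) {T : ℝ} (hT : 0 ≤ T) :
    ∫ t in (0 : ℝ)..T, D t ≤ 4 * C := by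
  have h1 := integral_convolution_le hDc hHc hD hHi hT
  have e : ∫ t in (0 : ℝ)..T, ∫ s in (0 : ℝ)..t, H (t - s) * D s =
      ∫ t in (0 : ℝ)..T, (D t - G t) := by
    refine intervalIntegral.integral_congr fun t ht => ?_
    rw [Set.uIcc_of_le hT] at ht
    linarith [heq t ht.1]
  rw [e, intervalIntegral.integral_sub (hDc.intervalIntegrable _ _)
    (hGc.intervalIntegrable _ _)] at h1
  have := hGi T hT
  linarith

/-- A maximum principle for `D/φ`. At a maximum point `a` over `[0, t]` the convolution is split at
`δa`. For later `s`, `φ(s)` is within a factor `7/6` of `φ(a)`, and the kernel mass `3/4` gives a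
contribution of `7/8` of the maximum, which is absorbed. For earlier `s` the kernel is already of
size `φ(a)` and only the total mass of `D` enters. -/
theorem le_of_renewal {D G H φ : ℝ → ℝ} (hDc : Continuous D) (hGc : Continuous G)
    (hHc : Continuous H) (hφc : Continuous φ) (hD : ∀ t, 0 ≤ t → 0 ≤ D t)
    (hH : ∀ t, 0 ≤ t → 0 ≤ H t) (hφ : ∀ t, 0 < φ t) (hφa : Antitone φ)
    (heq : ∀ t, 0 ≤ t → D t = G t + ∫ s in (0 : ℝ)..t, H (t - s) * D s)
    (hHi : ∀ t, 0 ≤ t → ∫ s in (0 : ℝ)..t, H s ≤ 3 / 4)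
    {C C₁ C₂ C₃ δ : ℝ} (hC₁ : 0 ≤ C₁) (hC₃ : 0 ≤ C₃)
    (hGi : ∀ t, 0 ≤ t → ∫ s in (0 : ℝ)..t, G s ≤ C)
    (hφδ : ∀ t, 0 ≤ t → φ (δ * t) ≤ 7 / 6 * φ t)
    (hφδ' : ∀ t, 0 ≤ t → φ ((1 - δ) * t) ≤ C₁ * φ t)
    (hG : ∀ t, 0 ≤ t → G t ≤ C₂ * φ t) (hHφ : ∀ t, 0 ≤ t → H t ≤ C₃ * φ t)
    {t : ℝ} (ht : 0 ≤ t) : D t ≤ 8 * (C₂ + 4 * C₁ * C₃ * C) * φ t := by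
  obtain ⟨a, ha, hmax⟩ := isCompact_Icc.exists_isMaxOn (Set.nonempty_Icc.2 ht)
    ((hDc.div hφc fun s => (hφ s).ne').continuousOn (s := Set.Icc 0 t))
  set M := D a / φ a with hM
  have hM0 : 0 ≤ M := div_nonneg (hD a ha.1) (hφ a).le
  have hDM : ∀ s ∈ Set.Icc 0 t, D s ≤ M * φ s := fun s hs => by
    have := hmax hs
    exact (div_le_iff₀ (hφ s)).1 this
  have hDa : D a = M * φ a := by rw [hM, div_mul_cancel₀ _ (hφ a).ne']
  have hpt : ∀ s ∈ Set.Icc 0 a, H (a - s) * D s ≤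
      7 / 6 * M * φ a * H (a - s) + C₁ * C₃ * φ a * D s := by
    intro s hs
    have hH0 := hH (a - s) (by linarith [hs.2])
    have hD0 := hD s hs.1
    rcases le_total (δ * a) s with h | h
    · have h1 : D s ≤ 7 / 6 * M * φ a := by
        calc D s ≤ M * φ s := hDM s ⟨hs.1, hs.2.trans ha.2⟩
          _ ≤ M * (7 / 6 * φ a) := by
              gcongr
              exact (hφa h).trans (hφδ a ha.1)
          _ = _ := by ring
      have h2 := mul_le_mul_of_nonneg_right h1 hH0
      have h3 : 0 ≤ C₁ * C₃ * φ a * D s :=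
        mul_nonneg (mul_nonneg (mul_nonneg hC₁ hC₃) (hφ a).le) hD0
      linarith
    · have h1 : H (a - s) ≤ C₁ * C₃ * φ a := by
        calc H (a - s) ≤ C₃ * φ (a - s) := hHφ _ (by linarith [hs.2])
          _ ≤ C₃ * (C₁ * φ a) := by
              gcongr
              exact (hφa (by linarith : (1 - δ) * a ≤ a - s)).trans (hφδ' a ha.1)
          _ = _ := by ring
      have h2 := mul_le_mul_of_nonneg_right h1 hD0
      have h3 : 0 ≤ 7 / 6 * M * φ a * H (a - s) :=
        mul_nonneg (mul_nonneg (by positivity) (hφ a).le) hH0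
      linarith
  have hHs : Continuous fun s => H (a - s) := by fun_prop
  have hint := intervalIntegral.integral_mono_on (μ := volume) ha.1
    (f := fun s => H (a - s) * D s)
    (g := fun s => 7 / 6 * M * φ a * H (a - s) + C₁ * C₃ * φ a * D s)
    (Continuous.intervalIntegrable (by fun_prop) 0 a)
    (Continuous.intervalIntegrable (by fun_prop) 0 a) hpt
  rw [intervalIntegral.integral_add ((hHs.const_mul _).intervalIntegrable 0 a)
    ((hDc.const_mul _).intervalIntegrable 0 a), intervalIntegral.integral_const_mul,
    intervalIntegral.integral_const_mul, intervalIntegral.integral_comp_sub_left (fun s => H s) a,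
    sub_self, sub_zero] at hint
  have h1 := hHi a ha.1
  have h2 := integral_le_of_renewal hDc hGc hHc hD heq hHi hGi ha.1
  have h3 := hG a ha.1
  have h4 := heq a ha.1
  have hφa0 := hφ a
  have h5 : 7 / 6 * M * φ a * ∫ s in (0 : ℝ)..a, H s ≤ 7 / 6 * M * φ a * (3 / 4) := by gcongr
  have h6 : C₁ * C₃ * φ a * ∫ s in (0 : ℝ)..a, D s ≤ C₁ * C₃ * φ a * (4 * C) := by gcongr
  have h7 : M * φ a ≤ 8 * (C₂ + 4 * C₁ * C₃ * C) * φ a := by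
    rw [← hDa]
    have : D a ≤ C₂ * φ a + (7 / 8 * D a + C₁ * C₃ * φ a * (4 * C)) := by
      rw [hDa] at h4 ⊢
      linarith
    linarith
  have h8 : M ≤ 8 * (C₂ + 4 * C₁ * C₃ * C) := le_of_mul_le_mul_right h7 hφa0
  exact (hDM t ⟨ht, le_rfl⟩).trans (mul_le_mul_of_nonneg_right h8 (hφ t).le)

/-! ### The gradient profile of the heat kernel -/

/-- The decay profile `((N ∧ √t) ∨ 1)^{-(d+2)}`. -/
def decayProfile (d N : ℕ) (t : ℝ) : ℝ := 1 / diffusiveScale N t ^ (d + 2)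

/-- The squared norm `‖e^{rL}(1_x - 1_y)‖²` at neighbouring vertices `x` and `y`. -/
def gradProfile (d N : ℕ) (r : ℝ) : ℝ :=
  2 * spectralMoment N 0 r ^ (d - 1) * spectralMoment N 1 r

/-- The energy loss `-g'/4` of the gradient profile `g`. -/
def lossProfile (d N : ℕ) (r : ℝ) : ℝ :=
  ((d - 1 : ℕ) : ℝ) * spectralMoment N 0 r ^ (d - 1 - 1) * spectralMoment N 1 r ^ 2 +
    spectralMoment N 0 r ^ (d - 1) * spectralMoment N 2 r

theorem continuous_diffusiveScale (N : ℕ) : Continuous (diffusiveScale N) := by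
  unfold diffusiveScale; fun_prop

theorem monotone_diffusiveScale (N : ℕ) : Monotone (diffusiveScale N) := fun _ _ h =>
  max_le_max (min_le_min le_rfl (Real.sqrt_le_sqrt h)) le_rfl

theorem mul_diffusiveScale_le (N : ℕ) {a t : ℝ} (ha : 0 ≤ a) (ha1 : a ≤ 1) :
    a * diffusiveScale N t ≤ diffusiveScale N (a ^ 2 * t) := by
  have hs : √(a ^ 2 * t) = a * √t := by
    rw [Real.sqrt_mul (by positivity), Real.sqrt_sq ha]
  unfold diffusiveScale
  rw [hs, mul_max_of_nonneg _ _ ha, mul_min_of_nonneg _ _ ha]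
  refine max_le_max (min_le_min ?_ le_rfl) (by linarith)
  exact mul_le_of_le_one_left (Nat.cast_nonneg N) ha1

theorem decayProfile_pos (d N : ℕ) (t : ℝ) : 0 < decayProfile d N t :=
  one_div_pos.2 (pow_pos (diffusiveScale_pos N t) _)

theorem decayProfile_le_one (d N : ℕ) (t : ℝ) : decayProfile d N t ≤ 1 :=
  div_le_one_of_le₀ (one_le_pow₀ (one_le_diffusiveScale N t)) (by
    have := diffusiveScale_pos N t; positivity)

theorem decayProfile_eq_one (d N : ℕ) {t : ℝ} (ht : t ≤ 1) : decayProfile d N t = 1 := by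
  simp [decayProfile, diffusiveScale_eq_one N ht]

theorem antitone_decayProfile (d N : ℕ) : Antitone (decayProfile d N) := fun s t h => by
  have := diffusiveScale_pos N s
  have := monotone_diffusiveScale N h
  unfold decayProfile
  gcongr

theorem continuous_decayProfile (d N : ℕ) : Continuous (decayProfile d N) :=
  continuous_const.div ((continuous_diffusiveScale N).pow _) fun t =>
    (pow_pos (diffusiveScale_pos N t) _).ne'

theorem decayProfile_mul_le (d N : ℕ) {a t : ℝ} (ha : 0 < a) (ha1 : a ≤ 1) :
    decayProfile d N (a ^ 2 * t) ≤ 1 / a ^ (d + 2) * decayProfile d N t := by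
  have hm := diffusiveScale_pos N t
  have := mul_diffusiveScale_le N (t := t) ha.le ha1
  unfold decayProfile
  rw [one_div_mul_one_div, ← mul_pow]
  gcongr

theorem decayProfile_half_le (d N : ℕ) (t : ℝ) :
    decayProfile d N (t / 2) ≤ 2 ^ (d + 2) * decayProfile d N t := by
  rcases le_total t 0 with ht | ht
  · rw [decayProfile_eq_one d N (by linarith), decayProfile_eq_one d N (by linarith), mul_one]
    exact one_le_pow₀ one_le_two
  · have h := decayProfile_mul_le d N (a := 1 / 2) (t := t) (by norm_num) (by norm_num)
    rw [one_div_pow _ (d + 2), one_div_one_div] at h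
    refine le_trans (antitone_decayProfile d N ?_) h
    norm_num
    linarith

/-- Up to time `N²` the profile is dominated by a multiple of `(1 + s)^{-3/2}`, which uses `d ≥ 1`;
afterwards it equals `β = N^{-(d+2)}`, and the factor `e^{-βs}` restores a bound uniform in `N` and
`T`. -/
theorem integral_decayProfile_mul_exp_le {d N : ℕ} (hd : 1 ≤ d) (hN : 1 ≤ N) {T : ℝ}
    (hT : 0 ≤ T) :
    ∫ s in (0 : ℝ)..T, decayProfile d N s * Real.exp (-(1 / (N : ℝ) ^ (d + 2)) * s) ≤ 9 := by
  have hN' : (0 : ℝ) < N := by positivity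
  set β : ℝ := 1 / (N : ℝ) ^ (d + 2) with hβ
  have hβ0 : 0 < β := by positivity
  -- An explicit antiderivative of a majorant valid in both regimes; its increase from `0` is at
  -- most `8 + 1 = 9`.
  set W : ℝ → ℝ := fun s => -8 * (√(1 + s))⁻¹ - Real.exp (-β * s) with hW
  have hderiv : ∀ x ∈ Set.Ioi (-1 : ℝ), HasDerivAt W
      (4 / ((1 + x) * √(1 + x)) + β * Real.exp (-β * x)) x := by
    intro x hx
    have hx0 : (0 : ℝ) < 1 + x := by have := Set.mem_Ioi.1 hx; linarith
    have hs : 0 < √(1 + x) := Real.sqrt_pos.2 hx0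
    have h1 : HasDerivAt (fun s : ℝ => √(1 + s)) (1 / (2 * √(1 + x))) x :=
      ((hasDerivAt_id x).const_add 1).sqrt hx0.ne'
    have h2 : HasDerivAt (fun s : ℝ => Real.exp (-β * s)) (Real.exp (-β * x) * (-β * 1)) x :=
      ((hasDerivAt_id x).const_mul (-β)).exp
    refine (((h1.inv hs.ne').const_mul (-8)).sub h2).congr_deriv ?_
    rw [Real.sq_sqrt hx0.le]
    field_simp
    ring
  have hpt : ∀ x ∈ Set.Ioo 0 T, decayProfile d N x * Real.exp (-β * x) ≤
      4 / ((1 + x) * √(1 + x)) + β * Real.exp (-β * x) := by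
    intro x hx
    have hx0 : 0 < x := hx.1
    have he1 : Real.exp (-β * x) ≤ 1 := Real.exp_le_one_iff.2 (by nlinarith)
    rcases le_total (N : ℝ) √x with h | h
    · have : decayProfile d N x = β := by rw [decayProfile, diffusiveScale_eq hN h]
      rw [this]
      have : 0 ≤ 4 / ((1 + x) * √(1 + x)) := by positivity
      linarith
    · set m := diffusiveScale N x with hm
      have hm1 : 1 ≤ m := one_le_diffusiveScale N x
      have hxm : x ≤ m ^ 2 := le_sq_diffusiveScale hx0.le h
      have h1 : 1 + x ≤ 2 * m ^ 2 := by nlinarith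
      have h2 : √(1 + x) ≤ 2 * m := by
        rw [Real.sqrt_le_left (by linarith)]
        nlinarith
      have h3 : decayProfile d N x ≤ 4 / ((1 + x) * √(1 + x)) := by
        calc decayProfile d N x ≤ 1 / m ^ 3 := by
              unfold decayProfile
              have : m ^ 3 ≤ m ^ (d + 2) := pow_le_pow_right₀ hm1 (by omega)
              gcongr
          _ = 4 / ((2 * m ^ 2) * (2 * m)) := by field_simp; norm_num
          _ ≤ _ := by gcongr
      have h4 : decayProfile d N x * Real.exp (-β * x) ≤ decayProfile d N x :=
        mul_le_of_le_one_right (decayProfile_pos d N x).le he1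
      have h5 : 0 ≤ β * Real.exp (-β * x) := by positivity
      linarith
  have hc : Continuous fun s => decayProfile d N s * Real.exp (-β * s) := by
    have := continuous_decayProfile d N
    fun_prop
  have h := intervalIntegral.integral_le_sub_of_hasDeriv_right_of_le hT
    (fun x hx => (hderiv x (Set.mem_Ioi.2 (by linarith [hx.1]))).continuousAt.continuousWithinAt)
    (fun x hx => (hderiv x (Set.mem_Ioi.2 (by linarith [hx.1]))).hasDerivWithinAt)
    (hc.continuousOn.integrableOn_compact isCompact_Icc) hpt
  refine h.trans ?_
  have h1 : 0 ≤ (√(1 + T))⁻¹ := by positivity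
  have h2 := Real.exp_pos (-β * T)
  simp only [hW, add_zero, Real.sqrt_one, inv_one, mul_zero, Real.exp_zero]
  linarith

theorem continuous_spectralMoment (N p : ℕ) : Continuous (spectralMoment N p) :=
  continuous_iff_continuousAt.2 fun r => (hasDerivAt_spectralMoment N p r).continuousAt

theorem continuous_gradProfile (d N : ℕ) : Continuous (gradProfile d N) := by
  have h0 := continuous_spectralMoment N 0
  have h1 := continuous_spectralMoment N 1
  unfold gradProfile
  fun_prop

theorem continuous_lossProfile (d N : ℕ) : Continuous (lossProfile d N) := by
  have h0 := continuous_spectralMoment N 0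
  have h1 := continuous_spectralMoment N 1
  have h2 := continuous_spectralMoment N 2
  unfold lossProfile
  fun_prop

theorem hasDerivAt_gradProfile (d N : ℕ) (r : ℝ) :
    HasDerivAt (gradProfile d N) (-4 * lossProfile d N r) r := by
  have h0 := hasDerivAt_spectralMoment N 0 r
  have h1 := hasDerivAt_spectralMoment N 1 r
  refine (((h0.pow (d - 1)).const_mul 2).mul h1).congr_deriv ?_
  simp only [lossProfile, zero_add, Nat.reduceAdd, Pi.pow_apply]
  ring

theorem gradProfile_nonneg (d N : ℕ) (r : ℝ) : 0 ≤ gradProfile d N r := by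
  have h0 := spectralMoment_nonneg N 0 r
  have h1 := spectralMoment_nonneg N 1 r
  unfold gradProfile
  positivity

theorem lossProfile_nonneg (d N : ℕ) (r : ℝ) : 0 ≤ lossProfile d N r := by
  have h0 := spectralMoment_nonneg N 0 r
  have h1 := spectralMoment_nonneg N 1 r
  have h2 := spectralMoment_nonneg N 2 r
  unfold lossProfile
  positivity

theorem antitone_gradProfile (d N : ℕ) : Antitone (gradProfile d N) :=
  antitone_of_deriv_nonpos (fun r => (hasDerivAt_gradProfile d N r).differentiableAt) fun r => by
    rw [(hasDerivAt_gradProfile d N r).deriv]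
    linarith [lossProfile_nonneg d N r]

/-- Eigenvalues are at most `2`, so each higher moment costs a factor `2`. The crude bound is enough
because the renewal argument needs the loss only up to constants, apart from its integral. -/
theorem lossProfile_le {d : ℕ} (hd : 1 ≤ d) (N : ℕ) (r : ℝ) :
    lossProfile d N r ≤ d * gradProfile d N r := by
  have h0 := spectralMoment_nonneg N 0 r
  have h1 := spectralMoment_nonneg N 1 r
  have h01 := spectralMoment_succ_le N 0 r
  have h12 := spectralMoment_succ_le N 1 r
  obtain ⟨n, rfl⟩ : ∃ n, d = n + 1 := ⟨d - 1, by omega⟩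
  simp only [lossProfile, gradProfile, Nat.add_sub_cancel, zero_add, Nat.reduceAdd] at *
  set K := spectralMoment N 0 r
  set A := spectralMoment N 1 r
  have hK : 0 ≤ K ^ n := by positivity
  have e1 : K ^ n * spectralMoment N 2 r ≤ K ^ n * (2 * A) := by gcongr
  have e2 : (n : ℝ) * K ^ (n - 1) * A ^ 2 ≤ n * (2 * K ^ n * A) := by
    cases n with
    | zero => simp
    | succ k =>
      simp only [Nat.add_sub_cancel]
      calc ((k + 1 : ℕ) : ℝ) * K ^ k * A ^ 2 = (k + 1 : ℕ) * K ^ k * A * A := by ring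
        _ ≤ (k + 1 : ℕ) * K ^ k * A * (2 * K) := by gcongr
        _ = _ := by ring
  push_cast
  nlinarith

theorem sum_cos_eq_zero {N : ℕ} (hN : 2 ≤ N) :
    ∑ n ∈ Finset.range N, Real.cos (2 * Real.pi * n / N) = 0 := by
  have h := (Complex.isPrimitiveRoot_exp N (by omega)).geom_sum_eq_zero (by omega)
  have h2 := congrArg Complex.re h
  rw [Complex.re_sum, Complex.zero_re] at h2
  rw [← h2]
  refine Finset.sum_congr rfl fun n _ => ?_
  rw [← Complex.exp_nat_mul, show (n : ℂ) * (2 * Real.pi * Complex.I / N) =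
    ((2 * Real.pi * n / N : ℝ) : ℂ) * Complex.I by push_cast; ring, Complex.exp_ofReal_mul_I_re]

theorem spectralMoment_one_zero {N : ℕ} (hN : 2 ≤ N) : spectralMoment N 1 0 = 1 := by
  have : (N : ℝ) ≠ 0 := by exact_mod_cast (by omega : N ≠ 0)
  simp [spectralMoment, cycleEigenvalue, sum_cos_eq_zero hN, this]

theorem gradProfile_zero (d : ℕ) {N : ℕ} (hN : 2 ≤ N) : gradProfile d N 0 = 2 := by
  simp [gradProfile, spectralMoment_one_zero hN, spectralMoment_zero_zero (by omega : 1 ≤ N)]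

/-- Each of the `d - 1` undifferentiated coordinates contributes `1/m` and the differentiated one
`1/m³`, with `m` the diffusive scale. Only the latter factor carries the exponential `e^{-2λr}`. -/
theorem gradProfile_bounds {d : ℕ} (hd : 1 ≤ d) : ∃ c C : ℝ, 0 < c ∧ 0 < C ∧
    ∀ N : ℕ, 4 ≤ N → ∀ r : ℝ, 0 ≤ r →
      c * decayProfile d N r * Real.exp (-(2 * cycleEigenvalue N 1 * r)) ≤ gradProfile d N r ∧
      gradProfile d N r ≤ C * decayProfile d N r * Real.exp (-(2 * cycleEigenvalue N 1 * r)) := by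
  refine ⟨2 * Real.exp (-4 * Real.pi ^ 2) ^ (d - 1) * (Real.exp (-Real.pi ^ 2) / 24),
    2 * 2 ^ (d - 1) * (47 + 2 * Real.exp 4), by positivity, by positivity, fun N hN r hr => ?_⟩
  have hm := diffusiveScale_pos N r
  have hK1 := le_spectralMoment_zero (by omega : 1 ≤ N) hr
  have hK2 := spectralMoment_zero_le (by omega : 1 ≤ N) hr
  have hA1 := le_spectralMoment_one (by omega : 2 ≤ N) hr
  have hA2 := spectralMoment_one_le hN hr
  have hK0 := spectralMoment_nonneg N 0 r
  have hA0 := spectralMoment_nonneg N 1 r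
  set m := diffusiveScale N r
  have hg : gradProfile d N r = 2 * spectralMoment N 0 r ^ (d - 1) *
      (Real.exp (2 * cycleEigenvalue N 1 * r) * spectralMoment N 1 r) *
      Real.exp (-(2 * cycleEigenvalue N 1 * r)) := by
    rw [Real.exp_neg, gradProfile]
    field_simp
  have hφ : ∀ a b : ℝ, 2 * a ^ (d - 1) * b * decayProfile d N r =
      2 * (a / m) ^ (d - 1) * (b / m ^ 3) := by
    intro a b
    obtain ⟨n, rfl⟩ : ∃ n, d = n + 1 := ⟨d - 1, by omega⟩
    rw [show decayProfile (n + 1) N r = 1 / m ^ (n + 1 + 2) from rfl]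
    simp only [Nat.add_sub_cancel, div_pow]
    field_simp
    ring
  rw [hg, hφ, hφ]
  constructor <;> gcongr

/-! ### Bounds for the mean square deviation -/

/-- Since the loss is `-g'/4`, integration by parts bounds the tilted mass by `g(0)/4 + (ρ/4) ∫ g
e^{ρs}`. The first term is `1/2`, and the hypothesis on `l * I` makes the second at most `1/4`. -/
theorem integral_lossProfile_mul_exp_le {d : ℕ} {N : ℕ} (hN : 2 ≤ N)
    {T l ρ I : ℝ} (hT : 0 ≤ T) (hρ : ρ ≤ 2 * l)
    (hI : ∫ s in (0 : ℝ)..T, gradProfile d N s * Real.exp (ρ * s) ≤ I) (hl : l * I ≤ 1 / 2) :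
    ∫ s in (0 : ℝ)..T, lossProfile d N s * Real.exp (ρ * s) ≤ 3 / 4 := by
  have hg := continuous_gradProfile d N
  have hh := continuous_lossProfile d N
  have hderiv : ∀ x ∈ Set.uIcc 0 T, HasDerivAt (fun s => -(1 / 4) * gradProfile d N s * Real.exp (ρ * s))
      (lossProfile d N x * Real.exp (ρ * x) - ρ / 4 * (gradProfile d N x * Real.exp (ρ * x))) x := by
    intro x _
    have h1 : HasDerivAt (fun s : ℝ => Real.exp (ρ * s)) (Real.exp (ρ * x) * (ρ * 1)) x :=
      ((hasDerivAt_id x).const_mul ρ).exp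
    refine (((hasDerivAt_gradProfile d N x).const_mul (-(1 / 4))).mul h1).congr_deriv ?_
    ring
  have h := intervalIntegral.integral_eq_sub_of_hasDerivAt hderiv
    (Continuous.intervalIntegrable (by fun_prop) 0 T)
  rw [intervalIntegral.integral_sub (Continuous.intervalIntegrable (by fun_prop) 0 T)
    (Continuous.intervalIntegrable (by fun_prop) 0 T), intervalIntegral.integral_const_mul] at h
  have h0 : 0 ≤ ∫ s in (0 : ℝ)..T, gradProfile d N s * Real.exp (ρ * s) :=
    intervalIntegral.integral_nonneg hT fun s _ =>
      mul_nonneg (gradProfile_nonneg d N s) (Real.exp_pos _).le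
  have h1 := mul_nonneg (gradProfile_nonneg d N T) (Real.exp_pos (ρ * T)).le
  have h2 := gradProfile_zero d hN
  have h3 : ρ / 4 * ∫ s in (0 : ℝ)..T, gradProfile d N s * Real.exp (ρ * s) ≤ 1 / 4 := by
    rcases le_total l 0 with hl0 | hl0
    · have : ρ ≤ 0 := by linarith
      nlinarith
    · nlinarith
  simp only [mul_zero, Real.exp_zero, mul_one] at h
  nlinarith

theorem integral_convolution_profile_le {d N : ℕ} (hd : 1 ≤ d) (hN : 1 ≤ N) {T : ℝ} (hT : 0 ≤ T) :
    ∫ s in (0 : ℝ)..T, decayProfile d N (T - s) *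
      Real.exp (-(1 / (N : ℝ) ^ (d + 2)) * (T - s)) * decayProfile d N s ≤
      18 * 2 ^ (d + 2) * min 1 T * decayProfile d N T := by
  have hN' : (0 : ℝ) < N := by positivity
  have hI := integral_decayProfile_mul_exp_le hd hN hT
  set β : ℝ := 1 / (N : ℝ) ^ (d + 2) with hβ
  have hβ0 : 0 < β := by positivity
  have hφ := continuous_decayProfile d N
  have hφ0 := decayProfile_pos d N
  have h2 : (1 : ℝ) ≤ 2 ^ (d + 2) := one_le_pow₀ one_le_two
  rcases le_total T 1 with hT1 | hT1
  · rw [min_eq_right hT1, decayProfile_eq_one d N hT1]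
    have h := intervalIntegral.integral_mono_on (μ := volume) hT
      (f := fun s => decayProfile d N (T - s) * Real.exp (-β * (T - s)) * decayProfile d N s)
      (g := fun _ => 1) (Continuous.intervalIntegrable (by fun_prop) 0 T)
      (Continuous.intervalIntegrable (by fun_prop) 0 T) (fun s hs => by
        have h1 : Real.exp (-β * (T - s)) ≤ 1 := Real.exp_le_one_iff.2 (by nlinarith [hs.2])
        have h3 := decayProfile_le_one d N (T - s)
        have h4 := decayProfile_le_one d N s
        have h5 := hφ0 s
        have h6 := Real.exp_pos (-β * (T - s))
        exact mul_le_one₀ (mul_le_one₀ h3 h6.le h1) h5.le h4)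
    rw [intervalIntegral.integral_const] at h
    simp only [sub_zero, smul_eq_mul, mul_one] at h ⊢
    nlinarith
  · rw [min_eq_left hT1, mul_one]
    -- One of `s` and `T - s` is at least `T/2`, and its profile is comparable to that at `T`. The
    -- exponential is kept with, or moved to, the other variable, so that each of the two remaining
    -- integrals is at most `9`.
    have hpt : ∀ s ∈ Set.Icc 0 T,
        decayProfile d N (T - s) * Real.exp (-β * (T - s)) * decayProfile d N s ≤
        2 ^ (d + 2) * decayProfile d N T * (decayProfile d N s * Real.exp (-β * s) +
          decayProfile d N (T - s) * Real.exp (-β * (T - s))) := by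
      intro s hs
      have hh := decayProfile_half_le d N T
      have p1 := hφ0 s
      have p2 := hφ0 (T - s)
      have p3 := hφ0 T
      have e1 := Real.exp_pos (-β * s)
      have e2 := Real.exp_pos (-β * (T - s))
      rcases le_total (T / 2) s with h | h
      · have h1 : decayProfile d N s ≤ 2 ^ (d + 2) * decayProfile d N T :=
          (antitone_decayProfile d N h).trans hh
        calc decayProfile d N (T - s) * Real.exp (-β * (T - s)) * decayProfile d N s
            ≤ decayProfile d N (T - s) * Real.exp (-β * (T - s)) *
              (2 ^ (d + 2) * decayProfile d N T) := by gcongr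
          _ ≤ _ := by
            have : 0 ≤ 2 ^ (d + 2) * decayProfile d N T *
              (decayProfile d N s * Real.exp (-β * s)) := by positivity
            linarith
      · have h1 : decayProfile d N (T - s) ≤ 2 ^ (d + 2) * decayProfile d N T :=
          (antitone_decayProfile d N (by linarith)).trans hh
        have h3 : Real.exp (-β * (T - s)) ≤ Real.exp (-β * s) :=
          Real.exp_le_exp.2 (by nlinarith)
        calc decayProfile d N (T - s) * Real.exp (-β * (T - s)) * decayProfile d N s
            ≤ (2 ^ (d + 2) * decayProfile d N T) * Real.exp (-β * s) * decayProfile d N s := by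
              gcongr
          _ ≤ _ := by
            have : 0 ≤ 2 ^ (d + 2) * decayProfile d N T *
              (decayProfile d N (T - s) * Real.exp (-β * (T - s))) := by positivity
            linarith
    have h := intervalIntegral.integral_mono_on (μ := volume) hT
      (Continuous.intervalIntegrable (by fun_prop) 0 T)
      (Continuous.intervalIntegrable (by fun_prop) 0 T) hpt
    rw [intervalIntegral.integral_const_mul, intervalIntegral.integral_add
      (Continuous.intervalIntegrable (by fun_prop) 0 T)
      (Continuous.intervalIntegrable (by fun_prop) 0 T),
      intervalIntegral.integral_comp_sub_left
        (fun s => decayProfile d N s * Real.exp (-β * s)) T, sub_self, sub_zero] at h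
    refine h.trans ?_
    have : 0 ≤ 2 ^ (d + 2) * decayProfile d N T := mul_nonneg (by positivity) (hφ0 T).le
    nlinarith

/-- The solution of the renewal equation with the gradient profile as source and the loss profile
as kernel decays like the gradient profile. -/
theorem exists_renewal_bound {d : ℕ} (hd : 1 ≤ d) : ∃ K : ℝ, 0 < K ∧ ∃ N₀ : ℕ, ∀ N : ℕ, N₀ ≤ N →
    ∀ D : ℝ → ℝ, Continuous D → (∀ t, 0 ≤ t → 0 ≤ D t) →
      (∀ t, 0 ≤ t → D t = d * gradProfile d N t +
        ∫ s in (0 : ℝ)..t, lossProfile d N (t - s) * D s) →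
      ∀ t, 0 ≤ t → D t * Real.exp ((2 * cycleEigenvalue N 1 - 1 / (N : ℝ) ^ (d + 2)) * t) ≤
        K * decayProfile d N t := by
  obtain ⟨c, C, -, hC, hb⟩ := gradProfile_bounds hd
  -- Chosen so that Bernoulli's inequality gives `a^{d+2} ≥ 6/7`; splitting at `δ = a²` then costs
  -- the factor `7/6` allowed by `le_of_renewal`.
  set a : ℝ := 1 - 1 / (7 * ((d : ℝ) + 2)) with ha
  have hdR : (1 : ℝ) ≤ d := by exact_mod_cast hd
  have hq : 1 / (7 * ((d : ℝ) + 2)) ≤ 1 / 21 := by gcongr; linarith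
  have hq0 : 0 < 1 / (7 * ((d : ℝ) + 2)) := by positivity
  have ha0 : 0 < a := by linarith
  have ha1 : a < 1 := by linarith
  have hapow : 6 / 7 ≤ a ^ (d + 2) := by
    have h := one_add_mul_le_pow (a := -(1 / (7 * ((d : ℝ) + 2)))) (by linarith) (d + 2)
    have e : 1 + ((d + 2 : ℕ) : ℝ) * -(1 / (7 * ((d : ℝ) + 2))) = 6 / 7 := by
      push_cast; field_simp; norm_num
    rw [e] at h
    rwa [ha, sub_eq_add_neg]
  -- The complementary fraction `1 - δ` is written as the square `b²`, the form required by the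
  -- scaling bound for the profile.
  set b : ℝ := √(1 - a ^ 2) with hbdef
  have hb1 : 0 < 1 - a ^ 2 := by nlinarith
  have hb0 : 0 < b := Real.sqrt_pos.2 hb1
  have hbsq : b ^ 2 = 1 - a ^ 2 := Real.sq_sqrt hb1.le
  have hble : b ≤ 1 := Real.sqrt_le_one.2 (by nlinarith)
  refine ⟨8 * (d * C + 4 * (1 / b ^ (d + 2)) * (d * C) * (d * (C * 9))), by positivity,
    -- The threshold ensures `λ · 9C ≤ 180 C/N² ≤ 1/2`, that is, subcriticality of the tilted
    -- kernel.
    max 4 ⌈360 * C⌉₊, fun N hN D hDc hD heq t ht => ?_⟩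
  have hN4 : 4 ≤ N := (le_max_left _ _).trans hN
  have hNC : 360 * C ≤ N := (Nat.le_ceil _).trans (by exact_mod_cast (le_max_right _ _).trans hN)
  have hN' : (4 : ℝ) ≤ N := by exact_mod_cast hN4
  set l := cycleEigenvalue N 1 with hl
  set β : ℝ := 1 / (N : ℝ) ^ (d + 2) with hβ
  have hβ0 : 0 < β := by positivity
  set ρ := 2 * l - β with hρ
  have hgρ : ∀ s, 0 ≤ s → gradProfile d N s * Real.exp (ρ * s) ≤
      C * (decayProfile d N s * Real.exp (-β * s)) := by
    intro s hs
    calc gradProfile d N s * Real.exp (ρ * s)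
        ≤ C * decayProfile d N s * Real.exp (-(2 * l * s)) * Real.exp (ρ * s) := by
          gcongr; exact (hb N hN4 s hs).2
      _ = _ := by
          rw [mul_assoc, ← Real.exp_add, mul_assoc, hρ]
          ring_nf
  have hgρ' : ∀ s, 0 ≤ s → gradProfile d N s * Real.exp (ρ * s) ≤ C * decayProfile d N s := by
    intro s hs
    refine (hgρ s hs).trans ?_
    have h1 : Real.exp (-β * s) ≤ 1 := Real.exp_le_one_iff.2 (by nlinarith)
    have h2 := decayProfile_pos d N s
    gcongr
    exact mul_le_of_le_one_right h2.le h1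
  have hgc := continuous_gradProfile d N
  have hhc := continuous_lossProfile d N
  have hφc := continuous_decayProfile d N
  have hgI : ∀ T, 0 ≤ T → ∫ s in (0 : ℝ)..T, gradProfile d N s * Real.exp (ρ * s) ≤ C * 9 := by
    intro T hT
    have h := intervalIntegral.integral_mono_on (μ := volume) hT
      (Continuous.intervalIntegrable (by fun_prop) 0 T)
      (Continuous.intervalIntegrable (by fun_prop) 0 T) fun s hs => hgρ s hs.1
    rw [intervalIntegral.integral_const_mul] at h
    refine h.trans ?_
    gcongr
    exact integral_decayProfile_mul_exp_le hd (by omega) hT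
  have hlC : l * (C * 9) ≤ 1 / 2 := by
    have h1 : l ≤ 20 / (N : ℝ) ^ 2 := cycleEigenvalue_one_le N
    calc l * (C * 9) ≤ 20 / (N : ℝ) ^ 2 * (C * 9) := by gcongr
      _ = 180 * C / (N : ℝ) ^ 2 := by ring
      _ ≤ 1 / 2 := by
        rw [div_le_iff₀ (by positivity)]
        nlinarith
  have hhI : ∀ T, 0 ≤ T → ∫ s in (0 : ℝ)..T, lossProfile d N s * Real.exp (ρ * s) ≤ 3 / 4 :=
    fun T hT => integral_lossProfile_mul_exp_le (by omega) hT (by linarith) (hgI T hT) hlC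
  -- Multiplication by `e^{ρt}` respects convolution, so the tilted functions satisfy a renewal
  -- equation of the same form.
  refine le_of_renewal (D := fun t => D t * Real.exp (ρ * t))
    (G := fun t => d * (gradProfile d N t * Real.exp (ρ * t)))
    (H := fun t => lossProfile d N t * Real.exp (ρ * t)) (δ := a ^ 2)
    (by fun_prop) (by fun_prop) (by fun_prop) hφc
    (fun t ht => mul_nonneg (hD t ht) (Real.exp_pos _).le)
    (fun t ht => mul_nonneg (lossProfile_nonneg d N t) (Real.exp_pos _).le)
    (decayProfile_pos d N) (antitone_decayProfile d N) ?_ hhI (by positivity) (by positivity)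
    ?_ ?_ ?_ ?_ ?_ ht
  · intro t ht
    rw [heq t ht, add_mul, ← intervalIntegral.integral_mul_const]
    congr 1
    · ring
    · refine intervalIntegral.integral_congr fun s _ => ?_
      change lossProfile d N (t - s) * D s * Real.exp (ρ * t) =
        lossProfile d N (t - s) * Real.exp (ρ * (t - s)) * (D s * Real.exp (ρ * s))
      rw [show ρ * t = ρ * (t - s) + ρ * s by ring, Real.exp_add]
      ring
  · intro t ht
    rw [intervalIntegral.integral_const_mul]
    gcongr
    exact hgI t ht
  · intro t _
    refine (decayProfile_mul_le d N ha0 ha1.le).trans ?_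
    have := decayProfile_pos d N t
    refine mul_le_mul_of_nonneg_right ?_ this.le
    rw [div_le_iff₀ (by positivity)]
    linarith
  · intro t _
    rw [← hbsq]
    exact decayProfile_mul_le d N hb0 hble
  · intro t ht
    rw [mul_assoc]
    exact mul_le_mul_of_nonneg_left (hgρ' t ht) (by positivity)
  · intro t ht
    calc lossProfile d N t * Real.exp (ρ * t) ≤ d * gradProfile d N t * Real.exp (ρ * t) := by
          gcongr; exact lossProfile_le hd N t
      _ = d * (gradProfile d N t * Real.exp (ρ * t)) := by ring
      _ ≤ d * (C * decayProfile d N t) :=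
          mul_le_mul_of_nonneg_left (hgρ' t ht) (by positivity)
      _ = _ := by ring

/-- Two-sided bounds for the convolution of the gradient profile with the solution of the renewal
equation. -/
theorem exists_convolution_bounds {d : ℕ} (hd : 1 ≤ d) : ∃ C₁ C₂ : ℝ, 0 < C₁ ∧ 0 < C₂ ∧
    ∃ N₀ : ℕ, ∀ N : ℕ, N₀ ≤ N → ∀ D : ℝ → ℝ, Continuous D → (∀ t, 0 ≤ t → 0 ≤ D t) →
      (∀ t, 0 ≤ t → D t = d * gradProfile d N t +
        ∫ s in (0 : ℝ)..t, lossProfile d N (t - s) * D s) →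
      ∀ t, 0 ≤ t →
        C₁ * min 1 t * (decayProfile d N t * Real.exp (-(2 * cycleEigenvalue N 1 * t))) ≤
          1 / 4 * ∫ s in (0 : ℝ)..t, gradProfile d N (t - s) * D s ∧
        1 / 4 * ∫ s in (0 : ℝ)..t, gradProfile d N (t - s) * D s ≤
          C₂ * min 1 t * (decayProfile d N t * Real.exp (-(2 * cycleEigenvalue N 1 * t))) *
            Real.exp (t / (N : ℝ) ^ (d + 2)) := by
  obtain ⟨c, C, hc, hC, hb⟩ := gradProfile_bounds hd
  obtain ⟨K, hK, N₁, hren⟩ := exists_renewal_bound hd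
  have hdR : (1 : ℝ) ≤ d := by exact_mod_cast hd
  refine ⟨1 / 4 * (d * (c * Real.exp (-4)) * c), 1 / 4 * (C * K * (18 * 2 ^ (d + 2))),
    by positivity, by positivity, max 4 N₁, fun N hN D hDc hD heq t ht => ?_⟩
  have hN4 : 4 ≤ N := (le_max_left _ _).trans hN
  have hren := hren N ((le_max_right _ _).trans hN) D hDc hD heq
  have hgc := continuous_gradProfile d N
  have hφc := continuous_decayProfile d N
  have hg0 := gradProfile_nonneg d N
  have hl2 := cycleEigenvalue_le_two N 1
  set l := cycleEigenvalue N 1 with hl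
  constructor
  · have hDg : ∀ s, 0 ≤ s → d * gradProfile d N s ≤ D s := by
      intro s hs
      rw [heq s hs]
      refine le_add_of_nonneg_right (intervalIntegral.integral_nonneg hs fun u hu => ?_)
      exact mul_nonneg (lossProfile_nonneg d N _) (hD u hu.1)
    have hg1 : c * Real.exp (-4) ≤ gradProfile d N 1 := by
      refine le_trans ?_ (hb N hN4 1 zero_le_one).1
      rw [decayProfile_eq_one d N le_rfl, mul_one]
      gcongr
      linarith
    -- Only the integral over `[0, 1 ∧ t]` is kept: there `D` is bounded below by a constant, and
    -- monotonicity replaces `g(t - s)` by `g(t)`.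
    set a := min 1 t with ha
    have ha0 : 0 ≤ a := le_min zero_le_one ht
    have hat : a ≤ t := min_le_right _ _
    have h1 : ∫ s in (0 : ℝ)..a, d * (c * Real.exp (-4)) * gradProfile d N t ≤
        ∫ s in (0 : ℝ)..a, gradProfile d N (t - s) * D s := by
      refine intervalIntegral.integral_mono_on ha0 (Continuous.intervalIntegrable (by fun_prop) 0 a)
        (Continuous.intervalIntegrable (by fun_prop) 0 a) fun s hs => ?_
      have h2 : gradProfile d N t ≤ gradProfile d N (t - s) :=
        antitone_gradProfile d N (by linarith [hs.1])
      have h3 : d * (c * Real.exp (-4)) ≤ D s := by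
        refine le_trans ?_ (hDg s hs.1)
        gcongr
        exact hg1.trans (antitone_gradProfile d N (hs.2.trans (min_le_left _ _)))
      rw [mul_comm]
      exact mul_le_mul h2 h3 (by positivity) (hg0 _)
    have h2 : ∫ s in (0 : ℝ)..a, gradProfile d N (t - s) * D s ≤
        ∫ s in (0 : ℝ)..t, gradProfile d N (t - s) * D s := by
      rw [← intervalIntegral.integral_add_adjacent_intervals
        (Continuous.intervalIntegrable (by fun_prop) 0 a)
        (Continuous.intervalIntegrable (by fun_prop) a t)]
      refine le_add_of_nonneg_right (intervalIntegral.integral_nonneg hat fun u hu => ?_)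
      exact mul_nonneg (hg0 _) (hD u (ha0.trans hu.1))
    rw [intervalIntegral.integral_const, smul_eq_mul, sub_zero] at h1
    have h3 := (hb N hN4 t ht).1
    calc 1 / 4 * (d * (c * Real.exp (-4)) * c) * a *
          (decayProfile d N t * Real.exp (-(2 * l * t)))
        = 1 / 4 * (a * (d * (c * Real.exp (-4)) *
          (c * decayProfile d N t * Real.exp (-(2 * l * t))))) := by ring
      _ ≤ 1 / 4 * (a * (d * (c * Real.exp (-4)) * gradProfile d N t)) := by gcongr
      _ ≤ _ := by gcongr; exact h1.trans h2
  · set β : ℝ := 1 / (N : ℝ) ^ (d + 2) with hβ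
    have hpt : ∀ s ∈ Set.Icc 0 t, gradProfile d N (t - s) * D s ≤
        C * K * Real.exp (-(2 * l * t)) * Real.exp (β * t) *
          (decayProfile d N (t - s) * Real.exp (-β * (t - s)) * decayProfile d N s) := by
      intro s hs
      have h1 := (hb N hN4 (t - s) (by linarith [hs.2])).2
      have h2 := hren s hs.1
      have h3 : D s ≤ K * decayProfile d N s * Real.exp (-((2 * l - β) * s)) := by
        rw [Real.exp_neg, ← div_eq_mul_inv, le_div_iff₀ (Real.exp_pos _)]
        exact h2
      have h4 := decayProfile_pos d N (t - s)
      refine (mul_le_mul h1 h3 (hD s hs.1) (by positivity)).trans (le_of_eq ?_)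
      have e : Real.exp (-(2 * l * (t - s))) * Real.exp (-((2 * l - β) * s)) =
          Real.exp (-(2 * l * t)) * Real.exp (β * t) * Real.exp (-β * (t - s)) := by
        rw [← Real.exp_add, ← Real.exp_add, ← Real.exp_add]
        ring_nf
      linear_combination C * decayProfile d N (t - s) * K * decayProfile d N s * e
    have h := intervalIntegral.integral_mono_on (μ := volume) ht
      (Continuous.intervalIntegrable (by fun_prop) 0 t)
      (Continuous.intervalIntegrable (by fun_prop) 0 t) hpt
    rw [intervalIntegral.integral_const_mul] at h
    have h2 := integral_convolution_profile_le hd (by omega : 1 ≤ N) ht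
    rw [← hβ] at h2
    calc 1 / 4 * ∫ s in (0 : ℝ)..t, gradProfile d N (t - s) * D s
        ≤ 1 / 4 * (C * K * Real.exp (-(2 * l * t)) * Real.exp (β * t) *
          (18 * 2 ^ (d + 2) * min 1 t * decayProfile d N t)) := by
          refine mul_le_mul_of_nonneg_left (h.trans ?_) (by norm_num)
          gcongr
      _ = _ := by
          rw [show β * t = t / (N : ℝ) ^ (d + 2) by rw [hβ]; ring]
          ring

/-! ### The nearest-neighbour structure and the discrete Laplacian -/

/-- The unit step in the `i`-th coordinate direction. -/
def unitStep {d N : ℕ} (i : Fin d) : Torus d N := Pi.single i 1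

/-- For `N ≥ 3` the classes `1` and `-1` are distinct and nonzero, so the `2d` signed unit steps
enumerate the neighbours without repetition. -/
theorem sum_neighborFinset {d N : ℕ} [NeZero N] (hN : 3 ≤ N) {M : Type*} [AddCommMonoid M]
    (x : Torus d N) (f : Torus d N → M) :
    ∑ y ∈ (torusGraph d N).neighborFinset x, f y =
      ∑ i, (f (x + unitStep i) + f (x - unitStep i)) := by
  classical
  have : Fact (1 < N) := ⟨by omega⟩
  have : Fact (2 < N) := ⟨by omega⟩
  set φ : Fin d × Bool → Torus d N :=
    fun p => if p.2 then x + unitStep p.1 else x - unitStep p.1 with hφ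
  have hne : ∀ i : Fin d, (unitStep i : Torus d N) ≠ 0 := fun i h => by
    have := congrFun h i
    simp [unitStep] at this
  have hinj : Function.Injective φ := by
    have key : ∀ i j : Fin d, ∀ a b : ZMod N, a ≠ 0 →
        (Pi.single i a : Torus d N) = Pi.single j b → i = j ∧ a = b := by
      intro i j a b ha h
      have h1 := congrFun h i
      by_cases hij : i = j
      · subst hij; simpa using h1
      · rw [Pi.single_eq_same, Pi.single_eq_of_ne hij] at h1
        exact absurd h1 ha
    have hneg : ∀ i : Fin d, x - Pi.single i 1 = x + Pi.single i (-1) := fun i => by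
      rw [sub_eq_add_neg, ← Pi.single_neg]
    rintro ⟨i, b⟩ ⟨j, c⟩ h
    have h11 : (-1 : ZMod N) ≠ 1 := ZMod.neg_one_ne_one
    have h0 : (-1 : ZMod N) ≠ 0 := neg_ne_zero.2 one_ne_zero
    cases b <;> cases c <;> simp only [hφ, hneg, unitStep, if_true, Bool.false_eq_true, if_false,
      add_right_inj] at h
    · rw [(key _ _ _ _ h0 h).1]
    · exact absurd (key _ _ _ _ h0 h).2 h11
    · exact absurd (key _ _ _ _ one_ne_zero h).2.symm h11
    · rw [(key _ _ _ _ one_ne_zero h).1]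
  have himage : (torusGraph d N).neighborFinset x = Finset.univ.image φ := by
    ext y
    rw [SimpleGraph.mem_neighborFinset]
    simp only [Finset.mem_image, Finset.mem_univ, true_and, Prod.exists, Bool.exists_bool, hφ]
    constructor
    · rintro ⟨-, i, h | h⟩
      · exact ⟨i, Or.inr (by simpa [unitStep] using h.symm)⟩
      · exact ⟨i, Or.inl (by simp [unitStep, h])⟩
    · rintro ⟨i, h | h⟩
      · simp only [Bool.false_eq_true, if_false] at h
        refine ⟨fun hxy => hne i ?_, i, Or.inr ?_⟩
        · rw [← hxy] at h; simpa using h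
        · rw [← h]; simp [unitStep]
      · simp only [if_true] at h
        refine ⟨fun hxy => hne i ?_, i, Or.inl ?_⟩
        · rw [← hxy] at h; simpa using h
        · exact h.symm
  rw [himage, Finset.sum_image hinj.injOn, Fintype.sum_prod_type]
  refine Finset.sum_congr rfl fun i _ => ?_
  rw [Fintype.sum_bool]
  simp [hφ]

theorem rwGenerator_apply {d N : ℕ} [NeZero N] (hN : 3 ≤ N) (ψ : Torus d N → ℝ) (x : Torus d N) :
    rwGenerator d N ψ x =
      1 / 2 * ∑ i, (ψ (x + unitStep i) + ψ (x - unitStep i) - 2 * ψ x) := by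
  have h : rwGenerator d N ψ x =
      1 / 2 * ∑ y ∈ (torusGraph d N).neighborFinset x, (ψ y - ψ x) := by
    simp [rwGenerator]
  rw [h, sum_neighborFinset hN]
  congr 1
  refine Finset.sum_congr rfl fun i _ => ?_
  ring

theorem sum_comp_add {d N : ℕ} [NeZero N] (e : Torus d N) (f : Torus d N → ℝ) :
    ∑ x, f (x + e) = ∑ x, f x := Equiv.sum_comp (Equiv.addRight e) f

/-- Summation by parts for the gradient of the torus. -/
theorem sum_grad_mul_grad {d N : ℕ} [NeZero N] (hN : 3 ≤ N) (u f : Torus d N → ℝ) :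
    ∑ x, ∑ i, (u (x + unitStep i) - u x) * (f (x + unitStep i) - f x) =
      -2 * ∑ x, u x * rwGenerator d N f x := by
  have h : ∀ i : Fin d, ∑ x, (u (x + unitStep i) - u x) * (f (x + unitStep i) - f x) =
      ∑ x, -(u x * (f (x + unitStep i) + f (x - unitStep i) - 2 * f x)) := by
    intro i
    have h1 := sum_comp_add (unitStep i) fun x : Torus d N => u x * f x
    have h2 := sum_comp_add (unitStep i) fun x : Torus d N => u x * f (x - unitStep i)
    simp only [add_sub_cancel_right] at h2
    rw [← sub_eq_zero, ← Finset.sum_sub_distrib]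
    have e : ∀ x : Torus d N, (u (x + unitStep i) - u x) * (f (x + unitStep i) - f x) -
        -(u x * (f (x + unitStep i) + f (x - unitStep i) - 2 * f x)) =
        (u (x + unitStep i) * f (x + unitStep i) - u x * f x) -
        (u (x + unitStep i) * f x - u x * f (x - unitStep i)) := fun x => by ring
    simp only [e, Finset.sum_sub_distrib]
    rw [h1, h2]; ring
  rw [Finset.sum_comm, Finset.sum_congr rfl fun i _ => h i, Finset.sum_comm, Finset.mul_sum]
  refine Finset.sum_congr rfl fun x _ => ?_
  rw [rwGenerator_apply hN, Finset.sum_neg_distrib, ← Finset.mul_sum]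
  ring

theorem sum_mul_rwGenerator_comm {d N : ℕ} [NeZero N] (hN : 3 ≤ N) (u f : Torus d N → ℝ) :
    ∑ x, u x * rwGenerator d N f x = ∑ x, f x * rwGenerator d N u x := by
  have h1 := sum_grad_mul_grad hN u f
  have h2 := sum_grad_mul_grad hN f u
  simp only [mul_comm (f _ - f _)] at h2
  linarith

theorem rwGenerator_comp_sub_left {d N : ℕ} [NeZero N] (hN : 3 ≤ N) (k : Torus d N → ℝ)
    (x y : Torus d N) : rwGenerator d N (fun z => k (x - z)) y = rwGenerator d N k (x - y) := by
  rw [rwGenerator_apply hN, rwGenerator_apply hN]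
  congr 1
  refine Finset.sum_congr rfl fun i _ => ?_
  rw [show x - (y + unitStep i) = x - y - unitStep i by abel,
    show x - (y - unitStep i) = x - y + unitStep i by abel, add_comm (k _)]

theorem rwGenerator_comp_sub_right {d N : ℕ} [NeZero N] (hN : 3 ≤ N) (k : Torus d N → ℝ)
    (x y : Torus d N) : rwGenerator d N (fun z => k (z - x)) y = rwGenerator d N k (y - x) := by
  rw [rwGenerator_apply hN, rwGenerator_apply hN]
  congr 1
  refine Finset.sum_congr rfl fun i _ => ?_
  rw [add_sub_right_comm y, sub_right_comm y]

/-! ### Fourier analysis on the cycle -/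

/-- The cosine `cos (2πa/N)` of a residue class `a` modulo `N`. -/
def cycleCos {N : ℕ} [NeZero N] (a : ZMod N) : ℝ := (ZMod.stdAddChar a).re

theorem cycleCos_zero {N : ℕ} [NeZero N] : cycleCos (0 : ZMod N) = 1 := by simp [cycleCos]

theorem cycleCos_add_add_cycleCos_sub {N : ℕ} [NeZero N] (a b : ZMod N) :
    cycleCos (a + b) + cycleCos (a - b) = 2 * cycleCos b * cycleCos a := by
  unfold cycleCos
  rw [sub_eq_add_neg, AddChar.map_add_eq_mul, AddChar.map_add_eq_mul, AddChar.map_neg_eq_conj]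
  simp only [Complex.mul_re, Complex.conj_re, Complex.conj_im]
  ring

theorem cycleCos_neg {N : ℕ} [NeZero N] (a : ZMod N) : cycleCos (-a) = cycleCos a := by
  unfold cycleCos
  rw [AddChar.map_neg_eq_conj, Complex.conj_re]

theorem one_sub_cycleCos {N : ℕ} [NeZero N] (a : ZMod N) :
    1 - cycleCos a = cycleEigenvalue N a.val := by
  unfold cycleCos cycleEigenvalue
  rw [ZMod.stdAddChar_apply, ZMod.toCircle_apply,
    show 2 * (Real.pi : ℂ) * Complex.I * (a.val : ℂ) / (N : ℂ) =
      ((2 * Real.pi * a.val / N : ℝ) : ℂ) * Complex.I by push_cast; ring,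
    Complex.exp_ofReal_mul_I_re]

theorem sum_cycleCos_mul {N : ℕ} [NeZero N] (a : ZMod N) :
    ∑ j : ZMod N, cycleCos (j * a) = if a = 0 then (N : ℝ) else 0 := by
  have h := congrArg Complex.re (AddChar.sum_mulShift a (ZMod.isPrimitive_stdAddChar N))
  rw [Complex.re_sum, ZMod.card] at h
  unfold cycleCos
  rw [h]
  split_ifs <;> simp

theorem sum_zmod_val {N : ℕ} [NeZero N] (f : ℕ → ℝ) :
    ∑ j : ZMod N, f j.val = ∑ n ∈ Finset.range N, f n := by
  obtain ⟨n, rfl⟩ : ∃ n, N = n + 1 := ⟨N - 1, by have := NeZero.pos N; omega⟩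
  exact Fin.sum_univ_eq_sum_range f (n + 1)

/-- The heat kernel of the simple random walk on the cycle. -/
def cycleKernel (N : ℕ) [NeZero N] (t : ℝ) (a : ZMod N) : ℝ :=
  1 / (N : ℝ) * ∑ j : ZMod N, cycleCos (j * a) * Real.exp (-t * (1 - cycleCos j))

theorem cycleKernel_zero {N : ℕ} [NeZero N] (a : ZMod N) :
    cycleKernel N 0 a = if a = 0 then 1 else 0 := by
  have : (N : ℝ) ≠ 0 := NeZero.ne _
  simp only [cycleKernel, neg_zero, zero_mul, Real.exp_zero, mul_one, sum_cycleCos_mul]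
  split_ifs <;> simp [this]

theorem cycleKernel_neg {N : ℕ} [NeZero N] (t : ℝ) (a : ZMod N) :
    cycleKernel N t (-a) = cycleKernel N t a := by
  simp only [cycleKernel, mul_neg, cycleCos_neg]

theorem hasDerivAt_cycleKernel {N : ℕ} [NeZero N] (t : ℝ) (a : ZMod N) :
    HasDerivAt (fun s => cycleKernel N s a)
      (1 / 2 * (cycleKernel N t (a + 1) + cycleKernel N t (a - 1) - 2 * cycleKernel N t a)) t := by
  unfold cycleKernel
  have h : HasDerivAt (fun s : ℝ => ∑ j : ZMod N,
      cycleCos (j * a) * Real.exp (-s * (1 - cycleCos j)))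
      (∑ j : ZMod N, cycleCos (j * a) *
        (Real.exp (-t * (1 - cycleCos j)) * (-1 * (1 - cycleCos j)))) t :=
    HasDerivAt.fun_sum fun j _ => (((hasDerivAt_id t).neg.mul_const _).exp.const_mul _)
  refine (h.const_mul (1 / (N : ℝ))).congr_deriv ?_
  rw [mul_left_comm (2 : ℝ), ← mul_add, ← mul_sub, mul_left_comm (1 / 2 : ℝ), Finset.mul_sum _ _ (2 : ℝ),
    ← Finset.sum_add_distrib, ← Finset.sum_sub_distrib, Finset.mul_sum _ _ (1 / 2 : ℝ)]
  congr 1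
  refine Finset.sum_congr rfl fun j _ => ?_
  have := cycleCos_add_add_cycleCos_sub (j * a) j
  rw [mul_add j, mul_sub j, mul_one j]
  linear_combination -(1 / 2) * Real.exp (-t * (1 - cycleCos j)) * this

theorem cycleKernel_apply_zero {N : ℕ} [NeZero N] (r : ℝ) :
    cycleKernel N (2 * r) 0 = spectralMoment N 0 r := by
  unfold cycleKernel spectralMoment
  rw [← sum_zmod_val]
  congr 1
  refine Finset.sum_congr rfl fun j _ => ?_
  rw [mul_zero, cycleCos_zero, one_sub_cycleCos, pow_zero, neg_mul 2]

theorem cycleKernel_zero_sub_one {N : ℕ} [NeZero N] (r : ℝ) :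
    cycleKernel N (2 * r) 0 - cycleKernel N (2 * r) 1 = spectralMoment N 1 r := by
  unfold cycleKernel spectralMoment
  rw [← sum_zmod_val, ← mul_sub, ← Finset.sum_sub_distrib]
  congr 1
  refine Finset.sum_congr rfl fun j _ => ?_
  rw [mul_zero, cycleCos_zero, mul_one, ← sub_mul, one_sub_cycleCos, pow_one, neg_mul 2]

/-! ### The heat kernel of the torus -/

theorem prod_add_single {d N : ℕ} (φ : Fin d → ZMod N → ℝ) (z : Torus d N) (i : Fin d)
    (a : ZMod N) : ∏ j, φ j ((z + Pi.single i a : Torus d N) j) =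
      φ i (z i + a) * ∏ j ∈ Finset.univ.erase i, φ j (z j) := by
  rw [← Finset.mul_prod_erase _ _ (Finset.mem_univ i)]
  congr 1
  · simp
  · refine Finset.prod_congr rfl fun j hj => ?_
    simp [Pi.single_eq_of_ne (Finset.ne_of_mem_erase hj)]

theorem prod_add_unitStep {d N : ℕ} (φ : Fin d → ZMod N → ℝ) (z : Torus d N) (i : Fin d) :
    ∏ j, φ j ((z + unitStep i : Torus d N) j) = φ i (z i + 1) * ∏ j ∈ Finset.univ.erase i, φ j (z j) :=
  prod_add_single φ z i 1

theorem prod_sub_unitStep {d N : ℕ} (φ : Fin d → ZMod N → ℝ) (z : Torus d N) (i : Fin d) :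
    ∏ j, φ j ((z - unitStep i : Torus d N) j) = φ i (z i - 1) * ∏ j ∈ Finset.univ.erase i, φ j (z j) := by
  rw [sub_eq_add_neg, sub_eq_add_neg, unitStep, ← Pi.single_neg]
  exact prod_add_single φ z i (-1)

/-- The heat kernel of the simple random walk on the torus. -/
def torusKernel (d N : ℕ) [NeZero N] (t : ℝ) (z : Torus d N) : ℝ := ∏ i, cycleKernel N t (z i)

theorem torusKernel_zero {d N : ℕ} [NeZero N] :
    torusKernel d N 0 = Pi.single 0 1 := by
  ext z
  simp only [torusKernel, cycleKernel_zero]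
  rw [Finset.prod_ite_zero, Finset.prod_const_one, Pi.single_apply]
  simp [funext_iff]

theorem torusKernel_neg {d N : ℕ} [NeZero N] (t : ℝ) (z : Torus d N) :
    torusKernel d N t (-z) = torusKernel d N t z := by
  simp [torusKernel, cycleKernel_neg]

theorem hasDerivAt_torusKernel {d N : ℕ} [NeZero N] (hN : 3 ≤ N) (t : ℝ) :
    HasDerivAt (torusKernel d N) (rwGenerator d N (torusKernel d N t)) t := by
  rw [hasDerivAt_pi]
  intro z
  unfold torusKernel
  refine (HasDerivAt.fun_finsetProd fun i _ => hasDerivAt_cycleKernel t (z i)).congr_deriv ?_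
  rw [rwGenerator_apply hN, Finset.mul_sum]
  refine Finset.sum_congr rfl fun i _ => ?_
  rw [prod_add_unitStep (fun _ => cycleKernel N t), prod_sub_unitStep (fun _ => cycleKernel N t),
    ← Finset.mul_prod_erase _ _ (Finset.mem_univ i), smul_eq_mul]
  ring

theorem torusKernel_unitStep {d N : ℕ} [NeZero N] (t : ℝ) (i : Fin d) :
    torusKernel d N t (unitStep i) = cycleKernel N t 1 * cycleKernel N t 0 ^ (d - 1) := by
  have h := prod_add_unitStep (N := N) (fun _ => cycleKernel N t) 0 i
  simpa [torusKernel] using h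

theorem torusKernel_zero_sub_unitStep {d N : ℕ} [NeZero N] (r : ℝ) (i : Fin d) :
    torusKernel d N (2 * r) 0 - torusKernel d N (2 * r) (unitStep i) = 1 / 2 * gradProfile d N r := by
  have hd : 1 ≤ d := i.pos
  have h0 : torusKernel d N (2 * r) 0 = cycleKernel N (2 * r) 0 * cycleKernel N (2 * r) 0 ^ (d - 1) := by
    rw [← pow_succ', Nat.sub_add_cancel hd]
    simp [torusKernel]
  rw [h0, torusKernel_unitStep, ← sub_mul, cycleKernel_zero_sub_one, cycleKernel_apply_zero,
    gradProfile]
  ring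

/-! ### The spectral gap -/

/-- The product of cosines with frequency vector `k`. -/
def torusCos {d N : ℕ} [NeZero N] (k z : Torus d N) : ℝ := ∏ i, cycleCos (k i * z i)

theorem rwGenerator_torusCos {d N : ℕ} [NeZero N] (hN : 3 ≤ N) (k z : Torus d N) :
    rwGenerator d N (torusCos k) z = -(∑ i, (1 - cycleCos (k i))) * torusCos k z := by
  rw [rwGenerator_apply hN, ← Finset.sum_neg_distrib, Finset.sum_mul, Finset.mul_sum]
  refine Finset.sum_congr rfl fun i _ => ?_
  unfold torusCos
  rw [prod_add_unitStep (fun j a => cycleCos (k j * a)),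
    prod_sub_unitStep (fun j a => cycleCos (k j * a)),
    ← Finset.mul_prod_erase _ _ (Finset.mem_univ i), mul_add (k i), mul_sub (k i), mul_one]
  linear_combination 1 / 2 * (∏ j ∈ Finset.univ.erase i, cycleCos (k j * z j)) *
    cycleCos_add_add_cycleCos_sub (k i * z i) (k i)

theorem sum_torusCos {d N : ℕ} [NeZero N] (z : Torus d N) :
    ∑ k, torusCos k z = if z = 0 then (N : ℝ) ^ d else 0 := by
  unfold torusCos
  have h := Finset.prod_univ_sum (fun _ : Fin d => (Finset.univ : Finset (ZMod N)))
    fun i a => cycleCos (a * z i)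
  rw [Fintype.piFinset_univ] at h
  rw [← h]
  simp only [sum_cycleCos_mul]
  rw [Finset.prod_ite_zero]
  simp [funext_iff]

/-- If `l` were none of these values, symmetry of `L` would force `f` to have zero convolution with
every product of cosines. Summed over all frequencies these products form `N^d` times a point mass,
so `f` would vanish. No eigenbasis is needed. -/
theorem eq_sum_of_hasEigenvalue {d N : ℕ} [NeZero N] (hN : 3 ≤ N) {l : ℝ} {f : Torus d N → ℝ}
    (hf : f ≠ 0) (hl : ∀ x, rwGenerator d N f x = -(l * f x)) :
    ∃ k : Torus d N, l = ∑ i, (1 - cycleCos (k i)) := by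
  by_contra! hcon
  apply hf
  have hF : ∀ k x : Torus d N, ∑ y, torusCos k (x - y) * f y = 0 := by
    intro k x
    have h := sum_mul_rwGenerator_comm hN (fun y => torusCos k (x - y)) f
    simp only [rwGenerator_comp_sub_left hN (torusCos k), rwGenerator_torusCos hN, hl] at h
    have h1 : ∑ y, torusCos k (x - y) * -(l * f y) = -l * ∑ y, torusCos k (x - y) * f y := by
      rw [Finset.mul_sum]; exact Finset.sum_congr rfl fun y _ => by ring
    have h2 : ∑ y, f y * (-(∑ i, (1 - cycleCos (k i))) * torusCos k (x - y)) =
        -(∑ i, (1 - cycleCos (k i))) * ∑ y, torusCos k (x - y) * f y := by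
      rw [Finset.mul_sum _ _ (-(∑ i, (1 - cycleCos (k i))))]
      exact Finset.sum_congr rfl fun y _ => by ring
    rw [h1, h2] at h
    have h3 : (l - ∑ i, (1 - cycleCos (k i))) * ∑ y, torusCos k (x - y) * f y = 0 := by
      linear_combination -h
    exact (mul_eq_zero.1 h3).resolve_left (sub_ne_zero.2 (hcon k))
  ext x
  have h := Finset.sum_eq_zero fun k (_ : k ∈ Finset.univ) => hF k x
  rw [Finset.sum_comm] at h
  simp only [← Finset.sum_mul, sum_torusCos, sub_eq_zero, ite_mul, zero_mul,
    Finset.sum_ite_eq, Finset.mem_univ, if_true] at h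
  have hN0 : (N : ℝ) ^ d ≠ 0 := pow_ne_zero _ (NeZero.ne _)
  exact (mul_eq_zero.1 h).resolve_left hN0

theorem spectralGap_eq {d N : ℕ} [NeZero N] (hd : 1 ≤ d) (hN : 3 ≤ N) :
    spectralGap d N = cycleEigenvalue N 1 := by
  have hN' : (0 : ℝ) < N := by exact_mod_cast (by omega : 0 < N)
  have hpos : 0 < cycleEigenvalue N 1 :=
    lt_of_lt_of_le (by positivity) (le_cycleEigenvalue_one (by omega : 2 ≤ N))
  have : Fact (1 < N) := ⟨by omega⟩
  refine IsLeast.csInf_eq ⟨⟨hpos.ne', ?_⟩, ?_⟩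
  · set k : Torus d N := unitStep ⟨0, hd⟩ with hk
    refine Module.End.hasEigenvalue_of_hasEigenvector (x := torusCos k)
      ⟨Module.End.mem_eigenspace_iff.2 ?_, fun h => ?_⟩
    · ext z
      have hsum : ∑ i, (1 - cycleCos (k i)) = cycleEigenvalue N 1 := by
        rw [Finset.sum_eq_single ⟨0, hd⟩]
        · rw [one_sub_cycleCos, hk, unitStep, Pi.single_eq_same, ZMod.val_one]
        · intro i _ hi
          rw [hk, unitStep, Pi.single_eq_of_ne hi, cycleCos_zero, sub_self]
        · simp
      have := rwGenerator_torusCos hN k z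
      rw [hsum] at this
      simp [this]
    · have := congrFun h 0
      simp [torusCos, cycleCos_zero] at this
  · rintro l ⟨hl0, hl⟩
    obtain ⟨f, hf⟩ := hl.exists_hasEigenvector
    have hfl : ∀ x, rwGenerator d N f x = -(l * f x) := by
      intro x
      have h := congrFun hf.apply_eq_smul x
      simp only [ContinuousLinearMap.coe_coe, neg_apply, Pi.neg_apply,
        Pi.smul_apply, smul_eq_mul] at h
      linarith
    obtain ⟨k, rfl⟩ := eq_sum_of_hasEigenvalue hN hf.2 hfl
    obtain ⟨i, -, hi⟩ := Finset.exists_ne_zero_of_sum_ne_zero hl0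
    have h0 : ∀ j ∈ Finset.univ, 0 ≤ 1 - cycleCos (k j) := fun j _ => by
      rw [one_sub_cycleCos]; exact cycleEigenvalue_nonneg _ _
    refine le_trans ?_ (Finset.single_le_sum h0 (Finset.mem_univ i))
    rw [one_sub_cycleCos] at hi ⊢
    refine cycleEigenvalue_one_le_of_ne (Nat.pos_of_ne_zero fun h => hi ?_) (ZMod.val_lt _)
    rw [h, cycleEigenvalue_zero]

/-! ### Semigroups of bounded operators -/

/-- The group `e^{tA}`, `t ∈ ℝ`, generated by a bounded operator `A`. -/
def operatorGroup {E : Type*} [NormedAddCommGroup E] [NormedSpace ℝ E] (A : E →L[ℝ] E) (t : ℝ) :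
    E →L[ℝ] E :=
  NormedSpace.exp (t • A)

theorem operatorGroup_zero {E : Type*} [NormedAddCommGroup E] [NormedSpace ℝ E] (A : E →L[ℝ] E)
    (f : E) : operatorGroup A 0 f = f := by
  simp [operatorGroup]

theorem hasDerivAt_exp_smul_apply {E : Type*} [NormedAddCommGroup E] [NormedSpace ℝ E]
    [CompleteSpace E] (A : E →L[ℝ] E) {F : ℝ → E} {F' : E} {s : ℝ} (hF : HasDerivAt F F' s) :
    HasDerivAt (fun s => operatorGroup A s (F s))
      (operatorGroup A s (A (F s) + F')) s := by
  unfold operatorGroup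
  refine ((hasDerivAt_exp_smul_const (𝕂 := ℝ) A s).clm_apply hF).congr_deriv ?_
  rw [map_add, mul_apply_eq_comp]

/-- Uniqueness for the linear equation `u' = A u`: the curve `s ↦ e^{sA} u(t - s)` is constant. It
identifies explicit solutions with the semigroup, both on functions on the torus and on observables.
-/
theorem eq_exp_smul_apply_of_hasDerivAt {E : Type*} [NormedAddCommGroup E] [NormedSpace ℝ E]
    [CompleteSpace E] (A : E →L[ℝ] E) {u : ℝ → E} (hu : ∀ s, HasDerivAt u (A (u s)) s) (t : ℝ) :
    u t = operatorGroup A t (u 0) := by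
  have hw : ∀ s, HasDerivAt (fun s => operatorGroup A s (u (t - s))) 0 s := by
    intro s
    have h1 : HasDerivAt (fun s => u (t - s)) (-A (u (t - s))) s := by
      exact (hu (t - s)).comp_const_sub t s
    refine (hasDerivAt_exp_smul_apply A h1).congr_deriv ?_
    rw [add_neg_cancel, map_zero]
  have h := is_const_of_deriv_eq_zero (fun s => (hw s).differentiableAt) (fun s => (hw s).deriv) 0 t
  simpa [operatorGroup_zero] using h

/-! ### The heat flow -/

theorem exp_rwGenerator_single {d N : ℕ} [NeZero N] (hN : 3 ≤ N) (t : ℝ) (x y : Torus d N) :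
    operatorGroup (rwGenerator d N) t (Pi.single x 1) y = torusKernel d N t (y - x) := by
  have hu : ∀ s, HasDerivAt (fun s => fun z => torusKernel d N s (z - x))
      (rwGenerator d N fun z => torusKernel d N s (z - x)) s := by
    intro s
    rw [hasDerivAt_pi]
    intro z
    rw [rwGenerator_comp_sub_right hN]
    exact hasDerivAt_pi.1 (hasDerivAt_torusKernel hN s) (z - x)
  have h := congrFun (eq_exp_smul_apply_of_hasDerivAt (rwGenerator d N) hu t) y
  have e : (fun z => torusKernel d N 0 (z - x)) = Pi.single x 1 := by
    ext z
    simp [torusKernel_zero, Pi.single_apply, sub_eq_zero]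
  rw [e] at h
  exact h.symm

theorem heatFlow_diracMass {d N : ℕ} [NeZero N] (hN : 3 ≤ N) (t : ℝ≥0) (x : Torus d N) :
    heatFlow d N (diracMass d N 0) t x = torusKernel d N t x := by
  have h : heatFlow d N (diracMass d N 0) t x =
      ∑ y, (Pi.single 0 1 : Torus d N → ℝ) y * torusKernel d N t (y - x) := by
    exact Finset.sum_congr rfl fun y _ =>
      congrArg (_ * ·) (exp_rwGenerator_single hN t x y)
  rw [h, Finset.sum_eq_single 0]
  · rw [Pi.single_eq_same, one_mul, zero_sub, torusKernel_neg]
  · intro y _ hy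
    rw [Pi.single_eq_of_ne hy, zero_mul]
  · simp

/-- Chapman–Kolmogorov at the origin together with evenness of the kernel. -/
theorem sum_sq_torusKernel {d N : ℕ} [NeZero N] (hN : 3 ≤ N) (t : ℝ) :
    ∑ x, torusKernel d N t x ^ 2 = torusKernel d N (2 * t) 0 := by
  have hu : ∀ s, HasDerivAt (fun s => torusKernel d N (t + s))
      (rwGenerator d N (torusKernel d N (t + s))) s := by
    intro s
    exact (hasDerivAt_torusKernel (d := d) hN (t + s)).comp_const_add t s
  have h := congrFun (eq_exp_smul_apply_of_hasDerivAt (rwGenerator d N) hu t) 0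
  rw [two_mul, h, add_zero]
  have e : torusKernel d N t = ∑ x, torusKernel d N t x • Pi.single x (1 : ℝ) := by
    ext z
    simp [Finset.sum_apply, Pi.single_apply]
  conv_rhs => rw [e]
  rw [map_sum, Finset.sum_apply]
  refine Finset.sum_congr rfl fun x _ => ?_
  rw [map_smul, Pi.smul_apply, exp_rwGenerator_single hN, zero_sub, torusKernel_neg, smul_eq_mul, sq]

/-! ### Quadratic functionals of the averaging process -/

/-- The mass at a vertex. -/
def massAt {d N : ℕ} [NeZero N] (x : Torus d N) : C(MassSpace d N, ℝ) where
  toFun η := η.1 x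
  continuous_toFun := (continuous_apply x).comp continuous_subtype_val

theorem massAt_apply {d N : ℕ} [NeZero N] (x : Torus d N) (η : MassSpace d N) :
    massAt x η = η.1 x := rfl

/-- The linear functional of the mass profile with coefficients `k`. -/
def massLinear {d N : ℕ} [NeZero N] (k : Torus d N → ℝ) : C(MassSpace d N, ℝ) :=
  ∑ x, k x • massAt x

/-- The translation invariant quadratic functional `∑ k (x - y) η(x) η(y)`. -/
def massForm {d N : ℕ} [NeZero N] (k : Torus d N → ℝ) : C(MassSpace d N, ℝ) :=
  ∑ x, ∑ y, k (x - y) • (massAt x * massAt y)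

/-- The energy `∑ (η(x) - η(y))²` over the edges of the torus. -/
def edgeEnergy (d N : ℕ) [NeZero N] : C(MassSpace d N, ℝ) :=
  ∑ x, ∑ i, (massAt (x + unitStep i) - massAt x) ^ 2

theorem massLinear_apply {d N : ℕ} [NeZero N] (k : Torus d N → ℝ) (η : MassSpace d N) :
    massLinear k η = ∑ x, η.1 x * k x := by
  simp [massLinear, massAt_apply, mul_comm]

theorem massForm_apply {d N : ℕ} [NeZero N] (k : Torus d N → ℝ) (η : MassSpace d N) :
    massForm k η = ∑ x, η.1 x * ∑ y, k (x - y) * η.1 y := by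
  simp only [massForm, ContinuousMap.sum_apply, ContinuousMap.smul_apply, ContinuousMap.mul_apply,
    massAt_apply, smul_eq_mul, Finset.mul_sum]
  exact Finset.sum_congr rfl fun x _ => Finset.sum_congr rfl fun y _ => by ring

theorem edgeEnergy_apply {d N : ℕ} [NeZero N] (η : MassSpace d N) :
    edgeEnergy d N η = ∑ x, ∑ i, (η.1 (x + unitStep i) - η.1 x) ^ 2 := by
  simp [edgeEnergy, massAt_apply]

theorem massForm_smul {d N : ℕ} [NeZero N] (c : ℝ) (k : Torus d N → ℝ) :
    massForm (c • k) = c • massForm k := by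
  simp only [massForm, Finset.smul_sum, Pi.smul_apply, smul_assoc]

theorem massForm_rwGenerator {d N : ℕ} [NeZero N] (hN : 3 ≤ N) (k : Torus d N → ℝ)
    (η : MassSpace d N) : massForm (rwGenerator d N k) η =
      ∑ x, η.1 x * rwGenerator d N (fun z => ∑ y, k (z - y) * η.1 y) x := by
  rw [massForm_apply]
  refine Finset.sum_congr rfl fun x _ => ?_
  congr 1
  have e : (fun z => ∑ y, k (z - y) * η.1 y) = ∑ y, η.1 y • fun z => k (z - y) := by
    ext z
    simp [Finset.sum_apply, mul_comm]
  rw [e, map_sum, Finset.sum_apply]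
  refine Finset.sum_congr rfl fun y _ => ?_
  rw [map_smul, Pi.smul_apply, rwGenerator_comp_sub_right hN, smul_eq_mul, mul_comm]

theorem massForm_rwGenerator_single {d N : ℕ} [NeZero N] (hN : 3 ≤ N) :
    massForm ((-2 : ℝ) • rwGenerator d N (Pi.single 0 1)) = edgeEnergy d N := by
  ext η
  have e : (fun z => ∑ y, (Pi.single 0 1 : Torus d N → ℝ) (z - y) * η.1 y) = η.1 := by
    ext z
    simp [Pi.single_apply, sub_eq_zero]
  rw [massForm_smul, ContinuousMap.smul_apply, massForm_rwGenerator hN, e, smul_eq_mul,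
    ← sum_grad_mul_grad hN, edgeEnergy_apply]
  simp only [sq]

theorem averageFun_eq_add {d N : ℕ} [NeZero N] (a b : Torus d N) (η : Torus d N → ℝ) (z : Torus d N) :
    averageFun a b η z =
      η z + (η b - η a) / 2 * ((if z = a then 1 else 0) - if z = b then 1 else 0) := by
  unfold averageFun
  by_cases ha : z = a
  · by_cases hb : z = b
    · subst ha; subst hb; simp
    · subst ha; simp [hb]; ring
  · by_cases hb : z = b
    · subst hb; simp [ha]; ring
    · simp [ha, hb]

theorem averageMap_comm {d N : ℕ} [NeZero N] (a b : Torus d N) :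
    averageMap a b = averageMap b a := by
  ext η z
  change averageFun a b η.1 z = averageFun b a η.1 z
  rw [averageFun_eq, averageFun_eq, Equiv.swap_comm]

/-- Every edge occurs twice in the sum over ordered pairs, which cancels the factor `1/2`. -/
theorem avgGenerator_apply {d N : ℕ} [NeZero N] (hN : 3 ≤ N) (f : C(MassSpace d N, ℝ))
    (η : MassSpace d N) : avgGenerator d N f η =
      ∑ x, ∑ i, (f (averageMap x (x + unitStep i) η) - f η) := by
  have h : avgGenerator d N f η = 1 / 2 * ∑ x, ∑ y ∈ (torusGraph d N).neighborFinset x,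
      (f (averageMap x y η) - f η) := by
    simp [avgGenerator]
  have h2 : ∑ x : Torus d N, ∑ i, (f (averageMap x (x - unitStep i) η) - f η) =
      ∑ x : Torus d N, ∑ i, (f (averageMap x (x + unitStep i) η) - f η) := by
    rw [Finset.sum_comm, Finset.sum_comm (s := Finset.univ (α := Torus d N))]
    refine Finset.sum_congr rfl fun i _ => ?_
    rw [← sum_comp_add (unitStep i)]
    refine Finset.sum_congr rfl fun x _ => ?_
    rw [add_sub_cancel_right, averageMap_comm]
  rw [h]
  simp only [sum_neighborFinset hN, Finset.sum_add_distrib]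
  rw [h2]
  ring

theorem sum_bump_mul {d N : ℕ} [NeZero N] (a b : Torus d N) (u g : Torus d N → ℝ) (c : ℝ) :
    ∑ x, (u x + c * ((if x = a then 1 else 0) - if x = b then 1 else 0)) * g x =
      ∑ x, u x * g x + c * (g a - g b) := by
  simp only [add_mul, Finset.sum_add_distrib, mul_assoc, sub_mul, ← Finset.mul_sum,
    Finset.sum_sub_distrib, ite_mul, one_mul, zero_mul, Finset.sum_ite_eq', Finset.mem_univ, if_true]

theorem avgGenerator_massLinear {d N : ℕ} [NeZero N] (hN : 3 ≤ N) (k : Torus d N → ℝ) :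
    avgGenerator d N (massLinear k) = massLinear (rwGenerator d N k) := by
  ext η
  have h := sum_grad_mul_grad hN η.1 k
  rw [avgGenerator_apply hN]
  have e : ∀ x : Torus d N, ∀ i, massLinear k (averageMap x (x + unitStep i) η) - massLinear k η =
      -(1 / 2) * ((η.1 (x + unitStep i) - η.1 x) * (k (x + unitStep i) - k x)) := by
    intro x i
    rw [massLinear_apply, massLinear_apply]
    change ∑ z, averageFun x (x + unitStep i) η.1 z * k z - _ = _
    simp only [averageFun_eq_add]
    rw [sum_bump_mul]
    ring
  simp only [e, ← Finset.mul_sum]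
  rw [h, massLinear_apply]
  ring

/-- Averaging adds a multiple of `1_a - 1_b` to the profile, so this is the exact second order
expansion of a quadratic form; evenness of `k` merges the two cross terms. -/
theorem massForm_averageMap {d N : ℕ} [NeZero N] {k : Torus d N → ℝ} (hk : ∀ z, k (-z) = k z)
    (a b : Torus d N) (η : MassSpace d N) :
    massForm k (averageMap a b η) - massForm k η =
      (η.1 b - η.1 a) * (∑ y, k (a - y) * η.1 y - ∑ y, k (b - y) * η.1 y) +
        (η.1 b - η.1 a) ^ 2 / 2 * (k 0 - k (b - a)) := by
  rw [massForm_apply, massForm_apply]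
  change ∑ x, averageFun a b η.1 x * ∑ y, k (x - y) * averageFun a b η.1 y - _ = _
  simp only [averageFun_eq_add]
  set c := (η.1 b - η.1 a) / 2 with hc
  have hinner : ∀ x : Torus d N, ∑ y, k (x - y) *
      (η.1 y + c * ((if y = a then 1 else 0) - if y = b then 1 else 0)) =
      ∑ y, k (x - y) * η.1 y + c * (k (x - a) - k (x - b)) := by
    intro x
    have := sum_bump_mul a b η.1 (fun y => k (x - y)) c
    simp only [mul_comm (k _)]
    exact this
  simp only [hinner]
  rw [sum_bump_mul]
  have hsymm : ∀ e : Torus d N, ∑ x, η.1 x * k (x - e) = ∑ y, k (e - y) * η.1 y := by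
    intro e
    refine Finset.sum_congr rfl fun x _ => ?_
    rw [← hk (x - e), neg_sub, mul_comm]
  have hsplit : ∑ x, η.1 x * (∑ y, k (x - y) * η.1 y + c * (k (x - a) - k (x - b))) =
      ∑ x, η.1 x * ∑ y, k (x - y) * η.1 y +
        c * (∑ y, k (a - y) * η.1 y - ∑ y, k (b - y) * η.1 y) := by
    rw [← hsymm a, ← hsymm b, ← Finset.sum_sub_distrib, Finset.mul_sum, ← Finset.sum_add_distrib]
    exact Finset.sum_congr rfl fun x _ => by ring
  rw [hsplit, sub_self, sub_self, ← hk (a - b), neg_sub]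
  have hc2 : η.1 b - η.1 a = 2 * c := by rw [hc]; ring
  rw [hc2]
  ring

/-- Summation by parts turns the first order terms of the expansion into the form of `L k`. The
second order terms share one coefficient because `k` is constant on unit steps, so they add up to a
multiple of the edge energy. -/
theorem avgGenerator_massForm {d N : ℕ} [NeZero N] (hN : 3 ≤ N) {k : Torus d N → ℝ}
    (hk : ∀ z, k (-z) = k z) {κ : ℝ} (hκ : ∀ i, k (unitStep i) = κ) :
    avgGenerator d N (massForm k) =
      (2 : ℝ) • massForm (rwGenerator d N k) + ((k 0 - κ) / 2) • edgeEnergy d N := by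
  ext η
  rw [avgGenerator_apply hN, ContinuousMap.add_apply, ContinuousMap.smul_apply,
    ContinuousMap.smul_apply, massForm_rwGenerator hN, edgeEnergy_apply]
  simp only [massForm_averageMap hk, add_sub_cancel_left, hκ, smul_eq_mul]
  have h := sum_grad_mul_grad hN η.1 fun z => ∑ y, k (z - y) * η.1 y
  simp only [Finset.sum_add_distrib]
  have e1 : ∑ x : Torus d N, ∑ i, (η.1 (x + unitStep i) - η.1 x) *
      (∑ y, k (x - y) * η.1 y - ∑ y, k (x + unitStep i - y) * η.1 y) =
      -∑ x : Torus d N, ∑ i, (η.1 (x + unitStep i) - η.1 x) *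
      (∑ y, k (x + unitStep i - y) * η.1 y - ∑ y, k (x - y) * η.1 y) := by
    simp only [← Finset.sum_neg_distrib, ← mul_neg, neg_sub]
  have e2 : ∑ x : Torus d N, ∑ i, (η.1 (x + unitStep i) - η.1 x) ^ 2 / 2 * (k 0 - κ) =
      (k 0 - κ) / 2 * ∑ x : Torus d N, ∑ i, (η.1 (x + unitStep i) - η.1 x) ^ 2 := by
    simp only [Finset.mul_sum]
    exact Finset.sum_congr rfl fun x _ => Finset.sum_congr rfl fun i _ => by ring
  rw [e1, e2, h]
  ring

/-! ### Expectations under the averaging semigroup -/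

/-- The expectation `(e^{s𝓛} f)(ξ)` of the functional `f` at time `s`. -/
def avgExpectation {d N : ℕ} [NeZero N] (ξ : MassSpace d N) (s : ℝ) (f : C(MassSpace d N, ℝ)) : ℝ :=
  operatorGroup (avgGenerator d N) s f ξ

theorem avgExpectation_add {d N : ℕ} [NeZero N] (ξ : MassSpace d N) (s : ℝ)
    (f g : C(MassSpace d N, ℝ)) :
    avgExpectation ξ s (f + g) = avgExpectation ξ s f + avgExpectation ξ s g := by
  simp [avgExpectation]

theorem avgExpectation_sub {d N : ℕ} [NeZero N] (ξ : MassSpace d N) (s : ℝ)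
    (f g : C(MassSpace d N, ℝ)) :
    avgExpectation ξ s (f - g) = avgExpectation ξ s f - avgExpectation ξ s g := by
  simp [avgExpectation]

theorem avgExpectation_smul {d N : ℕ} [NeZero N] (ξ : MassSpace d N) (s c : ℝ)
    (f : C(MassSpace d N, ℝ)) :
    avgExpectation ξ s (c • f) = c * avgExpectation ξ s f := by
  simp [avgExpectation]

theorem avgExpectation_zero {d N : ℕ} [NeZero N] (ξ : MassSpace d N) (f : C(MassSpace d N, ℝ)) :
    avgExpectation ξ 0 f = f ξ := by
  simp [avgExpectation, operatorGroup_zero]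

theorem hasDerivAt_avgExpectation {d N : ℕ} [NeZero N] (ξ : MassSpace d N)
    {F : ℝ → C(MassSpace d N, ℝ)} {F' : C(MassSpace d N, ℝ)} {s : ℝ} (hF : HasDerivAt F F' s) :
    HasDerivAt (fun s => avgExpectation ξ s (F s))
      (avgExpectation ξ s (avgGenerator d N (F s) + F')) s :=
  (ContinuousMap.evalCLM ℝ ξ : C(MassSpace d N, ℝ) →L[ℝ] ℝ).hasFDerivAt.comp_hasDerivAt s
    (hasDerivAt_exp_smul_apply (avgGenerator d N) hF)

theorem continuous_avgExpectation {d N : ℕ} [NeZero N] (ξ : MassSpace d N)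
    (f : C(MassSpace d N, ℝ)) : Continuous fun s => avgExpectation ξ s f :=
  continuous_iff_continuousAt.2 fun s =>
    (hasDerivAt_avgExpectation ξ (hasDerivAt_const s f)).continuousAt

theorem avgExpectation_one {d N : ℕ} [NeZero N] (hN : 3 ≤ N) (ξ : MassSpace d N) (t : ℝ) :
    avgExpectation ξ t 1 = 1 := by
  have hu : ∀ s : ℝ, HasDerivAt (fun _ : ℝ => (1 : C(MassSpace d N, ℝ)))
      (avgGenerator d N 1) s := by
    intro s
    have : avgGenerator d N (1 : C(MassSpace d N, ℝ)) = 0 := by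
      ext η
      rw [avgGenerator_apply hN]
      simp
    rw [this]
    exact hasDerivAt_const s _
  have h := eq_exp_smul_apply_of_hasDerivAt (avgGenerator d N) hu t
  rw [avgExpectation, ← h, ContinuousMap.one_apply]

theorem hasDerivAt_massForm {d N : ℕ} [NeZero N] {k : ℝ → Torus d N → ℝ} {k' : Torus d N → ℝ}
    {s : ℝ} (hk : HasDerivAt k k' s) : HasDerivAt (fun s => massForm (k s)) (massForm k') s := by
  unfold massForm
  exact HasDerivAt.fun_sum fun x _ => HasDerivAt.fun_sum fun y _ =>
    (hasDerivAt_pi.1 hk (x - y)).smul_const (F := C(MassSpace d N, ℝ)) _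

theorem hasDerivAt_massLinear {d N : ℕ} [NeZero N] {k : ℝ → Torus d N → ℝ} {k' : Torus d N → ℝ}
    {s : ℝ} (hk : HasDerivAt k k' s) : HasDerivAt (fun s => massLinear (k s)) (massLinear k') s := by
  unfold massLinear
  exact HasDerivAt.fun_sum fun x _ => (hasDerivAt_pi.1 hk x).smul_const (F := C(MassSpace d N, ℝ)) _

theorem avgExpectation_massAt {d N : ℕ} [NeZero N] (hN : 3 ≤ N) (t : ℝ) (x : Torus d N) :
    avgExpectation (diracMass d N 0) t (massAt x) = torusKernel d N t x := by
  have hu : ∀ s, HasDerivAt (fun s => massLinear fun y => torusKernel d N s (x - y))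
      (avgGenerator d N (massLinear fun y => torusKernel d N s (x - y))) s := by
    intro s
    rw [avgGenerator_massLinear hN]
    refine hasDerivAt_massLinear (hasDerivAt_pi.2 fun y => ?_)
    rw [rwGenerator_comp_sub_left hN]
    exact hasDerivAt_pi.1 (hasDerivAt_torusKernel hN s) (x - y)
  have h := eq_exp_smul_apply_of_hasDerivAt (avgGenerator d N) hu t
  have e : massLinear (fun y => torusKernel d N 0 (x - y)) = massAt x := by
    ext η
    rw [massLinear_apply, massAt_apply, torusKernel_zero]
    simp [Pi.single_apply, sub_eq_zero]
  rw [e] at h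
  rw [avgExpectation, ← h, massLinear_apply, Finset.sum_eq_single 0]
  · simp [diracMass]
  · intro y _ hy
    simp [diracMass, hy]
  · simp

theorem massForm_diracMass {d N : ℕ} [NeZero N] (k : Torus d N → ℝ) :
    massForm k (diracMass d N 0) = k 0 := by
  rw [massForm_apply]
  simp [diracMass, Pi.single_apply]

/-- Duhamel's formula: a quadratic functional transported by the heat flow changes in expectation
only through the energy. -/
theorem avgExpectation_massForm {d N : ℕ} [NeZero N] (hN : 3 ≤ N) {k : ℝ → Torus d N → ℝ}
    (hk : ∀ r, HasDerivAt k (rwGenerator d N (k r)) r) (hneg : ∀ r z, k r (-z) = k r z)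
    (i₀ : Fin d) (hstep : ∀ r i, k r (unitStep i) = k r (unitStep i₀)) (ξ : MassSpace d N) (T : ℝ) :
    avgExpectation ξ T (massForm (k 0)) = massForm (k (2 * T)) ξ +
      ∫ s in (0 : ℝ)..T, (k (2 * (T - s)) 0 - k (2 * (T - s)) (unitStep i₀)) / 2 *
        avgExpectation ξ s (edgeEnergy d N) := by
  have hderiv : ∀ s ∈ Set.uIcc 0 T,
      HasDerivAt (fun s => avgExpectation ξ s (massForm (k (2 * (T - s)))))
        ((k (2 * (T - s)) 0 - k (2 * (T - s)) (unitStep i₀)) / 2 *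
          avgExpectation ξ s (edgeEnergy d N)) s := by
    intro s _
    -- The kernel runs backwards at speed `2`, so that its derivative cancels the term `2 L k` of
    -- the generator.
    have h1 : HasDerivAt (fun s => k (2 * (T - s)))
        ((-2 : ℝ) • rwGenerator d N (k (2 * (T - s)))) s := by
      rw [hasDerivAt_pi]
      intro z
      have := (hasDerivAt_pi.1 (hk (2 * (T - s))) z).comp s
        (((hasDerivAt_id s).const_sub T).const_mul 2)
      refine this.congr_deriv ?_
      simp only [Pi.smul_apply, smul_eq_mul]
      ring
    refine (hasDerivAt_avgExpectation ξ (hasDerivAt_massForm h1)).congr_deriv ?_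
    rw [avgGenerator_massForm hN (hneg _) (hstep _), massForm_smul, neg_smul,
      add_neg_cancel_comm, avgExpectation_smul]
  have hkc : Continuous k := continuous_iff_continuousAt.2 fun r => (hk r).continuousAt
  have hEc := continuous_avgExpectation ξ (edgeEnergy d N)
  have hkz : ∀ z, Continuous fun r => k r z := fun z => (continuous_apply z).comp hkc
  have hk0 := hkz 0
  have hk1 := hkz (unitStep i₀)
  have h := intervalIntegral.integral_eq_sub_of_hasDerivAt hderiv
    (Continuous.intervalIntegrable (by fun_prop) 0 T)
  rw [h]
  simp only [sub_self, mul_zero, sub_zero, avgExpectation_zero]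
  ring

theorem torusKernel_unitStep_eq {d N : ℕ} [NeZero N] (r : ℝ) (i j : Fin d) :
    torusKernel d N r (unitStep i) = torusKernel d N r (unitStep j) := by
  rw [torusKernel_unitStep, torusKernel_unitStep]

theorem avgExpectation_massForm_single {d N : ℕ} [NeZero N] (hd : 1 ≤ d) (hN : 3 ≤ N) (T : ℝ) :
    avgExpectation (diracMass d N 0) T (massForm (Pi.single 0 1)) = torusKernel d N (2 * T) 0 +
      1 / 4 * ∫ s in (0 : ℝ)..T, gradProfile d N (T - s) *
        avgExpectation (diracMass d N 0) s (edgeEnergy d N) := by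
  have h := avgExpectation_massForm hN (hasDerivAt_torusKernel hN) torusKernel_neg ⟨0, hd⟩
    (fun r i => torusKernel_unitStep_eq r i _) (diracMass d N 0) T
  rw [torusKernel_zero, massForm_diracMass] at h
  rw [h, ← intervalIntegral.integral_const_mul]
  congr 1
  refine intervalIntegral.integral_congr fun s _ => ?_
  simp only [torusKernel_zero_sub_unitStep]
  ring

theorem avgExpectation_edgeEnergy {d N : ℕ} [NeZero N] (hd : 1 ≤ d) (hN : 3 ≤ N) (T : ℝ) :
    avgExpectation (diracMass d N 0) T (edgeEnergy d N) = d * gradProfile d N T +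
      ∫ s in (0 : ℝ)..T, lossProfile d N (T - s) *
        avgExpectation (diracMass d N 0) s (edgeEnergy d N) := by
  have hP := hasDerivAt_torusKernel (d := d) hN
  have hk : ∀ r, HasDerivAt (fun r => (-2 : ℝ) • rwGenerator d N (torusKernel d N r))
      (rwGenerator d N ((-2 : ℝ) • rwGenerator d N (torusKernel d N r))) r := by
    intro r
    have h : HasDerivAt (fun r => rwGenerator d N (torusKernel d N r))
        (rwGenerator d N (rwGenerator d N (torusKernel d N r))) r :=
      (rwGenerator d N).hasFDerivAt.comp_hasDerivAt r (hP r)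
    rw [map_smul, hasDerivAt_pi]
    exact fun z => (hasDerivAt_pi.1 h z).const_mul (-2)
  have hneg : ∀ (r : ℝ) z, ((-2 : ℝ) • rwGenerator d N (torusKernel d N r)) (-z) =
      ((-2 : ℝ) • rwGenerator d N (torusKernel d N r)) z := by
    intro r z
    have h := rwGenerator_comp_sub_left hN (torusKernel d N r) 0 z
    simp only [zero_sub, torusKernel_neg] at h
    rw [Pi.smul_apply, Pi.smul_apply, ← h]
  set i₀ : Fin d := ⟨0, hd⟩
  have hstep : ∀ (r : ℝ) i, ((-2 : ℝ) • rwGenerator d N (torusKernel d N r)) (unitStep i) =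
      ((-2 : ℝ) • rwGenerator d N (torusKernel d N r)) (unitStep i₀) := by
    intro r i
    -- The heat kernel agrees at all unit steps for all times, hence so does its time derivative,
    -- which is `L` applied to it.
    have h1 := hasDerivAt_pi.1 (hP r) (unitStep i)
    have h2 := hasDerivAt_pi.1 (hP r) (unitStep i₀)
    simp only [torusKernel_unitStep_eq _ i i₀] at h1
    rw [Pi.smul_apply, Pi.smul_apply, h1.unique h2]
  have hloss : ∀ r, rwGenerator d N (torusKernel d N (2 * r)) 0 -
      rwGenerator d N (torusKernel d N (2 * r)) (unitStep i₀) = -lossProfile d N r := by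
    intro r
    have h : ∀ z, HasDerivAt (fun r => torusKernel d N (2 * r) z)
        (2 * rwGenerator d N (torusKernel d N (2 * r)) z) r := by
      intro z
      have := (hasDerivAt_pi.1 (hP (2 * r)) z).comp r ((hasDerivAt_id r).const_mul 2)
      refine this.congr_deriv ?_
      ring
    -- Differentiating `p_{2r}(0) - p_{2r}(e) = g(r)/2` in two ways identifies the Duhamel kernel
    -- with the loss `-g'/4`.
    have h1 := (h 0).sub (h (unitStep i₀))
    have h2 := (hasDerivAt_gradProfile d N r).const_mul (1 / 2)
    have e : (fun r => torusKernel d N (2 * r) 0) - (fun r => torusKernel d N (2 * r) (unitStep i₀)) =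
        fun r => 1 / 2 * gradProfile d N r := by
      ext r
      exact torusKernel_zero_sub_unitStep r i₀
    rw [e] at h1
    have := h1.unique h2
    linarith
  have h := avgExpectation_massForm hN hk hneg i₀ hstep (diracMass d N 0) T
  rw [torusKernel_zero, massForm_rwGenerator_single hN, massForm_diracMass] at h
  rw [h]
  congr 1
  · rw [Pi.smul_apply, rwGenerator_apply hN]
    have e : ∀ i : Fin d, torusKernel d N (2 * T) (0 + unitStep i) +
        torusKernel d N (2 * T) (0 - unitStep i) - 2 * torusKernel d N (2 * T) 0 =
        -gradProfile d N T := by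
      intro i
      have := torusKernel_zero_sub_unitStep (N := N) T i
      rw [zero_add, zero_sub, torusKernel_neg]
      linarith
    simp only [e, Finset.sum_const, Finset.card_univ, Fintype.card_fin, nsmul_eq_mul, smul_eq_mul]
    ring
  · refine intervalIntegral.integral_congr fun s _ => ?_
    have := hloss (T - s)
    simp only [Pi.smul_apply, smul_eq_mul]
    rw [show lossProfile d N (T - s) = -(rwGenerator d N (torusKernel d N (2 * (T - s))) 0 -
      rwGenerator d N (torusKernel d N (2 * (T - s))) (unitStep i₀)) by rw [this, neg_neg]]
    ring

/-! ### The mean square deviation of the averaging process -/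

/-- The Markov property from time `0`, integrated. One-time expectations are thus determined by the
generator, and no path regularity is needed. -/
theorem IsAveragingProcess.integral_eq {d N : ℕ} [NeZero N] {Ω : Type*} [MeasurableSpace Ω]
    {P : Measure Ω} {ξ : MassSpace d N} {η : ℝ≥0 → Ω → MassSpace d N}
    (h : IsAveragingProcess P ξ η) (f : C(MassSpace d N, ℝ)) (t : ℝ≥0) :
    ∫ ω, f (η t ω) ∂P = avgExpectation ξ t f := by
  have := h.isProbabilityMeasure
  have hm : (⨆ r : Set.Iic (0 : ℝ≥0), MeasurableSpace.comap (η r.1) inferInstance) ≤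
      (inferInstance : MeasurableSpace Ω) := iSup_le fun r => (h.measurable r.1).comap_le
  rw [← integral_condExp hm, integral_congr_ae (h.markov f 0 t zero_le)]
  have h0 : (fun ω => avgSemigroup d N (t - 0) f (η 0 ω)) =ᵐ[P] fun _ => avgExpectation ξ t f := by
    filter_upwards [h.initial] with ω hω
    rw [hω, tsub_zero]
    rfl
  rw [integral_congr_ae h0]
  simp

theorem avgExpectation_massLinear {d N : ℕ} [NeZero N] (hN : 3 ≤ N) (t : ℝ) (p : Torus d N → ℝ) :
    avgExpectation (diracMass d N 0) t (massLinear p) = ∑ x, p x * torusKernel d N t x := by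
  simp only [← avgExpectation_massAt hN]
  simp [avgExpectation, massLinear]

theorem IsAveragingProcess.meanSqDeviation_eq {d N : ℕ} [NeZero N] (hd : 1 ≤ d) (hN : 3 ≤ N)
    {Ω : Type*} [MeasurableSpace Ω] {P : Measure Ω} {η : ℝ≥0 → Ω → MassSpace d N}
    (h : IsAveragingProcess P (diracMass d N 0) η) (t : ℝ≥0) :
    meanSqDeviation P (diracMass d N 0) η t = (N : ℝ) ^ d *
      (1 / 4 * ∫ s in (0 : ℝ)..t, gradProfile d N (t - s) *
        avgExpectation (diracMass d N 0) s (edgeEnergy d N)) := by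
  have hN0 : (N : ℝ) ≠ 0 := NeZero.ne _
  set p : Torus d N → ℝ := torusKernel d N t with hp
  -- The expanded square. In expectation the linear part gives `-2 ∑ p²`, leaving `∑ E η² - ∑ p²`,
  -- where `∑ p² = p_{2t}(0)` cancels the initial term of Duhamel's formula.
  set f : C(MassSpace d N, ℝ) := (N : ℝ) ^ d • (massForm (Pi.single 0 1) - (2 : ℝ) • massLinear p +
    (∑ x, p x ^ 2) • 1) with hf
  have hfη : ∀ μ : MassSpace d N, l2NormSq d N (fun x => μ.1 x / uniformMass d N x -
      heatFlow d N (diracMass d N 0) t x / uniformMass d N x) = f μ := by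
    intro μ
    have e : ∀ x, ∑ y, (Pi.single 0 1 : Torus d N → ℝ) (x - y) * μ.1 y = μ.1 x := by
      intro x
      simp [Pi.single_apply, sub_eq_zero]
    have hR : f μ = (N : ℝ) ^ d * (∑ x, μ.1 x * μ.1 x - 2 * ∑ x, μ.1 x * p x + ∑ x, p x ^ 2) := by
      simp only [hf, ContinuousMap.smul_apply, ContinuousMap.add_apply, ContinuousMap.sub_apply,
        massForm_apply, massLinear_apply, e, ContinuousMap.one_apply, smul_eq_mul, mul_one]
    rw [hR, Finset.mul_sum Finset.univ _ (2 : ℝ), ← Finset.sum_sub_distrib,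
      ← Finset.sum_add_distrib, Finset.mul_sum]
    unfold l2NormSq
    refine Finset.sum_congr rfl fun x _ => ?_
    simp only [sq_abs, heatFlow_diracMass hN, ← hp]
    unfold uniformMass
    field_simp
    ring
  unfold meanSqDeviation
  simp only [hfη]
  rw [h.integral_eq f t, hf, avgExpectation_smul, avgExpectation_add, avgExpectation_sub,
    avgExpectation_smul, avgExpectation_smul, avgExpectation_one hN, avgExpectation_massLinear hN,
    avgExpectation_massForm_single hd hN, ← sum_sq_torusKernel hN, ← hp]
  have e : ∑ x, p x * p x = ∑ x, p x ^ 2 := Finset.sum_congr rfl fun x _ => (sq _).symm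
  rw [e]
  ring

/-! ### Comparison with `Xi` and the concentration time scale. -/

theorem sqrt_pow_eq_rpow (d : ℕ) {t : ℝ} (ht : 0 ≤ t) : √t ^ (d + 2) = t ^ ((d : ℝ) / 2 + 1) := by
  rw [Real.sqrt_eq_rpow, ← Real.rpow_natCast, ← Real.rpow_mul ht]
  congr 1
  push_cast
  ring

theorem diffusiveScale_pow (d N : ℕ) {t : ℝ} (ht : 0 ≤ t) : diffusiveScale N t ^ (d + 2) =
    max (min ((N : ℝ) ^ (d + 2)) (t ^ ((d : ℝ) / 2 + 1))) 1 := by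
  have hmono : MonotoneOn (fun x : ℝ => x ^ (d + 2)) (Set.Ici 0) := fun x hx y _ h =>
    pow_le_pow_left₀ hx h _
  have hN : (N : ℝ) ∈ Set.Ici (0 : ℝ) := Set.mem_Ici.2 (Nat.cast_nonneg N)
  have hs : √t ∈ Set.Ici (0 : ℝ) := Set.mem_Ici.2 (Real.sqrt_nonneg t)
  have h1 := hmono.map_max (a := min (N : ℝ) √t) (b := 1) (Set.mem_Ici.2 (le_min hN hs)) (Set.mem_Ici.2 zero_le_one)
  have h2 := hmono.map_min hN hs
  simp only [one_pow] at h1 h2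
  rw [diffusiveScale, h1, h2, sqrt_pow_eq_rpow d ht]

theorem Xi_eq {d N : ℕ} [NeZero N] (hd : 1 ≤ d) (hN : 3 ≤ N) (t : ℝ≥0) :
    Xi d N t = (N : ℝ) ^ d * (decayProfile d N t *
      Real.exp (-(2 * cycleEigenvalue N 1 * t))) := by
  rw [Xi, ← diffusiveScale_pow d N (NNReal.coe_nonneg t), relaxationTime, spectralGap_eq hd hN, decayProfile,
    show -2 * (t : ℝ) / (1 / cycleEigenvalue N 1) = -(2 * cycleEigenvalue N 1 * t) by
      rw [div_div_eq_mul_div, div_one]; ring]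
  ring

theorem exists_meanSqDeviation_bounds {d : ℕ} (hd : 1 ≤ d) : ∃ C₁ C₂ : ℝ, 0 < C₁ ∧ 0 < C₂ ∧
    ∃ N₀ : ℕ, ∀ (N : ℕ) [NeZero N], N₀ ≤ N →
      ∀ (Ω : Type*) [MeasurableSpace Ω] (P : Measure Ω) (η : ℝ≥0 → Ω → MassSpace d N),
        IsAveragingProcess P (diracMass d N 0) η →
        ∀ t : ℝ≥0,
          C₁ * min 1 (t : ℝ) * Xi d N t ≤ meanSqDeviation P (diracMass d N 0) η t ∧
          meanSqDeviation P (diracMass d N 0) η t ≤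
            C₂ * min 1 (t : ℝ) * Xi d N t * Real.exp ((t : ℝ) / (N : ℝ) ^ (d + 2)) := by
  obtain ⟨C₁, C₂, hC₁, hC₂, N₀, hb⟩ := exists_convolution_bounds hd
  refine ⟨C₁, C₂, hC₁, hC₂, max 3 N₀, fun N _ hN Ω _ P η h t => ?_⟩
  have hN3 : 3 ≤ N := (le_max_left _ _).trans hN
  obtain ⟨hl, hu⟩ := hb N ((le_max_right _ _).trans hN)
    (fun s => avgExpectation (diracMass d N 0) s (edgeEnergy d N))
    -- Positivity of the expected energy is read off from the process: it is the integral of a sum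
    -- of squares.
    (continuous_avgExpectation _ _) (fun s hs => by
      have := h.integral_eq (edgeEnergy d N) s.toNNReal
      rw [Real.coe_toNNReal s hs] at this
      rw [← this]
      refine integral_nonneg fun ω => ?_
      rw [Pi.zero_apply, edgeEnergy_apply]
      positivity)
    (fun s _ => avgExpectation_edgeEnergy hd hN3 s) t (NNReal.coe_nonneg t)
  have hNd : 0 ≤ (N : ℝ) ^ d := by positivity
  rw [h.meanSqDeviation_eq hd hN3, Xi_eq hd hN3]
  constructor
  · refine le_trans (le_of_eq ?_) (mul_le_mul_of_nonneg_left hl hNd)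
    ring
  · refine (mul_le_mul_of_nonneg_left hu hNd).trans (le_of_eq ?_)
    ring

/-- Past time `N²` the left side is `N⁻²`, and `X ≤ N` suffices. Before that it is at most `N^d
t^{-(d/2+1)}`, and `N^d` is exactly the power `d/2 + 1` of `N^{2d/(d+2)}`. -/
theorem pow_mul_decayProfile_le {d N : ℕ} (hN : 1 ≤ N) {t X : ℝ} (hX : 1 ≤ X) (hXN : X ≤ N)
    (ht : X ≤ t / (N : ℝ) ^ (2 * (d : ℝ) / ((d : ℝ) + 2))) :
    (N : ℝ) ^ d * decayProfile d N t ≤ 1 / X := by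
  have hN' : (1 : ℝ) ≤ N := by exact_mod_cast hN
  have hN0 : (0 : ℝ) < N := by positivity
  have hX0 : 0 < X := by linarith
  rw [decayProfile, mul_one_div]
  rcases le_total (N : ℝ) √t with h | h
  · rw [diffusiveScale_eq hN h, pow_add, div_mul_eq_div_div, div_self (by positivity)]
    gcongr
    nlinarith
  · rw [le_div_iff₀ (by positivity)] at ht
    have ht0 : 0 ≤ t := le_trans (by positivity) ht
    have hs : √t ≤ diffusiveScale N t := by
      rw [diffusiveScale, min_eq_right h]; exact le_max_left _ _
    have hkey : X * (N : ℝ) ^ d ≤ diffusiveScale N t ^ (d + 2) := by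
      calc X * (N : ℝ) ^ d ≤ X ^ ((d : ℝ) / 2 + 1) * (N : ℝ) ^ d := by
            gcongr
            exact Real.self_le_rpow_of_one_le hX (by
              have : (0 : ℝ) ≤ d := Nat.cast_nonneg d
              linarith)
        _ = (X * (N : ℝ) ^ (2 * (d : ℝ) / ((d : ℝ) + 2))) ^ ((d : ℝ) / 2 + 1) := by
            rw [Real.mul_rpow hX0.le (by positivity), ← Real.rpow_mul hN0.le,
              show 2 * (d : ℝ) / ((d : ℝ) + 2) * ((d : ℝ) / 2 + 1) = d by field_simp,
              Real.rpow_natCast]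
        _ ≤ t ^ ((d : ℝ) / 2 + 1) := by gcongr
        _ = √t ^ (d + 2) := (sqrt_pow_eq_rpow d ht0).symm
        _ ≤ _ := by gcongr
    have hm := diffusiveScale_pos N t
    rw [div_le_div_iff₀ (by positivity) hX0]
    linarith

/-- The gap is at least `8/N²`, hence larger than `N^{-(d+2)}`, so the decay `e^{-2λt}` outweighs
the growing correction. -/
theorem Xi_mul_exp_le {d N : ℕ} [NeZero N] (hd : 1 ≤ d) (hN : 3 ≤ N) (t : ℝ≥0) :
    Xi d N t * Real.exp ((t : ℝ) / (N : ℝ) ^ (d + 2)) ≤ (N : ℝ) ^ d * decayProfile d N t := by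
  have hN' : (1 : ℝ) ≤ N := by exact_mod_cast (by omega : 1 ≤ N)
  have hN0 : (0 : ℝ) < N := by positivity
  have hl := le_cycleEigenvalue_one (by omega : 2 ≤ N)
  have hβ : 1 / (N : ℝ) ^ (d + 2) ≤ cycleEigenvalue N 1 := by
    refine le_trans ?_ hl
    have : (N : ℝ) ^ 2 ≤ (N : ℝ) ^ (d + 2) := pow_le_pow_right₀ hN' (by omega)
    gcongr
    norm_num
  have he : Real.exp (-(2 * cycleEigenvalue N 1 * t)) * Real.exp ((t : ℝ) / (N : ℝ) ^ (d + 2)) ≤ 1 := by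
    rw [← Real.exp_add, Real.exp_le_one_iff, div_eq_mul_one_div]
    have ht := NNReal.coe_nonneg t
    nlinarith [mul_le_mul_of_nonneg_left hβ ht, mul_nonneg ht (cycleEigenvalue_nonneg N 1)]
  have h0 : 0 ≤ (N : ℝ) ^ d * decayProfile d N t :=
    mul_nonneg (by positivity) (decayProfile_pos d N t).le
  rw [Xi_eq hd hN]
  calc _ = (N : ℝ) ^ d * decayProfile d N t * (Real.exp (-(2 * cycleEigenvalue N 1 * t)) *
        Real.exp ((t : ℝ) / (N : ℝ) ^ (d + 2))) := by ring
    _ ≤ _ := mul_le_of_le_one_right h0 he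

end

theorem theorem2 (d : ℕ) (hd : 1 ≤ d) :
    (∃ B C₁ C₂ : ℝ, 0 < B ∧ 0 < C₁ ∧ 0 < C₂ ∧ ∃ N₀ : ℕ, ∀ (N : ℕ) [NeZero N], N₀ ≤ N →
      ∀ (Ω : Type*) [MeasurableSpace Ω] (P : Measure Ω) (η : ℝ≥0 → Ω → MassSpace d N),
        IsAveragingProcess P (diracMass d N 0) η →
        ∀ t : ℝ≥0,
          C₁ * min 1 (t : ℝ) * Xi d N t ≤ meanSqDeviation P (diracMass d N 0) η t ∧
          meanSqDeviation P (diracMass d N 0) η t ≤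
            C₂ * min 1 (t : ℝ) * Xi d N t * Real.exp (B * (t : ℝ) / (N : ℝ) ^ (d + 2))) ∧
    (∀ t : ℕ → ℝ≥0,
      Tendsto (fun N : ℕ => (t N : ℝ) / (N : ℝ) ^ (2 * (d : ℝ) / ((d : ℝ) + 2))) atTop atTop →
      ∀ ε : ℝ, 0 < ε → ∀ᶠ N : ℕ in atTop, ∀ [NeZero N],
        ∀ (Ω : Type*) [MeasurableSpace Ω] (P : Measure Ω) (η : ℝ≥0 → Ω → MassSpace d N),
          IsAveragingProcess P (diracMass d N 0) η →
          meanSqDeviation P (diracMass d N 0) η (t N) < ε) := by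
  constructor
  · obtain ⟨C₁, C₂, hC₁, hC₂, N₀, hb⟩ := exists_meanSqDeviation_bounds hd
    refine ⟨1, C₁, C₂, one_pos, hC₁, hC₂, N₀, fun N _ hN Ω _ P η h t => ?_⟩
    rw [one_mul]
    exact hb N hN Ω P η h t
  · intro t ht ε hε
    obtain ⟨C₁, C₂, -, hC₂, N₀, hb⟩ := exists_meanSqDeviation_bounds hd
    -- The factor `2` makes the final bound `C₂/X ≤ ε/2` strict.
    set X : ℝ := max 1 (2 * C₂ / ε) with hX
    have hX1 : 1 ≤ X := le_max_left _ _
    have hXε : 2 * C₂ / ε ≤ X := le_max_right _ _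
    filter_upwards [ht.eventually_ge_atTop X, eventually_ge_atTop (max 3 N₀),
      tendsto_natCast_atTop_atTop.eventually_ge_atTop X] with N h1 h2 h3
    intro _ Ω _ P η h
    have hN3 : 3 ≤ N := (le_max_left _ _).trans h2
    have hupper := (hb N ((le_max_right _ _).trans h2) Ω P η h (t N)).2
    have hXi := (Xi_mul_exp_le hd hN3 (t N)).trans
      (pow_mul_decayProfile_le (by omega) hX1 h3 h1)
    have hXi0 : 0 ≤ Xi d N (t N) * Real.exp ((t N : ℝ) / (N : ℝ) ^ (d + 2)) := by
      rw [Xi_eq hd hN3]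
      have := decayProfile_pos d N (t N)
      positivity
    calc meanSqDeviation P (diracMass d N 0) η (t N)
        ≤ C₂ * min 1 (t N : ℝ) * Xi d N (t N) * Real.exp ((t N : ℝ) / (N : ℝ) ^ (d + 2)) := hupper
      _ = C₂ * (min 1 (t N : ℝ) * (Xi d N (t N) * Real.exp ((t N : ℝ) / (N : ℝ) ^ (d + 2)))) := by
          ring
      _ ≤ C₂ * (1 * (1 / X)) := by
          gcongr
          exact min_le_left _ _
      _ < ε := by
          rw [one_mul, mul_one_div, div_lt_iff₀ (by linarith)]
          rw [div_le_iff₀ hε] at hXε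
          nlinarith
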